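/- Let $n\ge 3$, let $\vec e_1=(1,0,\dots,0)\in\mathbb R^n$, and let $V_1,V_2:\mathbb R^n\to\mathbb R$ be compactly supported potentials with $V_\kappa,\nabla V_\kappa\in L^\infty$. Put $H_\kappa=-\frac12\triangle+V_\kappa$ on $L^2(\mathbb R^n;\mathbb C)$ and let $P_b(H_\kappa)$ be the orthogonal projection of $L^2$ onto the closed span of the bound states of $H_\kappa$, i.e. of the $L^2$ eigenfunctions of $H_\kappa$ with negative eigenvalues. For $\vec v\in\mathbb R^n$, $t\in\mathbb R$ let $$(\mathfrak g_{\vec v}(t)f)(x)=e^{-i\frac{|\vec v|^2}{2}t}\,e^{-ix\cdot\vec v}\,f(x+t\vec v),\qquad P_b(H_2,t)=\mathfrak g_{-\vec e_1}(t)\,P_b(H_2)\,\mathfrak g_{\vec e_1}(t).$$ For $\psi_0\in L^2$ let $\psi(t)=U(t)\psi_0\in C([0,\infty);L^2)$ denote the solution of the charge transfer equation $$\frac1i\partial_t\psi-\frac12\triangle\psi+V_1\psi+V_2(\cdot-t\vec e_1)\psi=0,\qquad \psi|_{t=0}=\psi_0,$$ where the equation is understood in the sense of tempered distributions in $x$ for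 every $t\ge0$. Then there are constants $\alpha>0$ and $C>0$, depending only on $n,V_1,V_2$, such that for every $\psi_0\in L^2$ whose solution is asymptotically orthogonal to the bound states of $H_1$ and $H_2$, i.e. $$\|P_b(H_1)U(t)\psi_0\|_{L^2}+\|P_b(H_2,t)U(t)\psi_0\|_{L^2}\to0\quad\text{as }t\to+\infty,$$ one has $$\|P_b(H_1)U(t)\psi_0\|_{L^2}+\|P_b(H_2,t)U(t)\psi_0\|_{L^2}\le C\,e^{-\alpha t}\,\|\psi_0\|_{L^2}\qquad\text{for all }t\ge0.$$ -/

import Mathlib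

open MeasureTheory Filter Topology Set
open scoped SchwartzMap Laplacian NNReal

noncomputable section

namespace ChargeTransfer

/-- The Euclidean space `ℝⁿ`. -/
abbrev Space (n : ℕ) : Type := EuclideanSpace ℝ (Fin n)

/-- The complex Hilbert space `L²(ℝⁿ)`. -/
abbrev L2 (n : ℕ) : Type := Lp ℂ 2 (volume : Measure (Space n))

/-- The unit vector `e₁ = (1, 0, …, 0)` of `ℝⁿ` (for `n ≥ 1`). -/
def e₁ (n : ℕ) : Space n := WithLp.toLp 2 (fun i => if (i : ℕ) = 0 then 1 else 0)

/-- Real, compactly supported potentials `V` with `V, ∇V ∈ L^∞`. The condition `V, ∇V ∈ L^∞` is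
expressed through the Lipschitz representative of `V`; boundedness of `V` follows from continuity
and compact support. -/
structure IsPotential {n : ℕ} (V : Space n → ℝ) : Prop where
  lipschitz : ∃ K : ℝ≥0, LipschitzWith K V
  compactSupport : HasCompactSupport V

/-- The function `-(1/2) Δ φ + V φ`, for a Schwartz function `φ`. -/
def schrodinger {n : ℕ} (V : Space n → ℝ) (φ : 𝓢(Space n, ℂ)) (x : Space n) : ℂ :=
  -(1 / 2 : ℂ) * (Δ φ) x + (V x : ℂ) * φ x

/-- `u ∈ L²` satisfies `(-(1/2) Δ + V) u = E u` in the sense of tempered distributions.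
For bounded real `V` this says that `u` lies in the domain `H²(ℝⁿ)` of the self-adjoint operator
`-(1/2) Δ + V` and `(-(1/2) Δ + V) u = E u`. -/
def SolvesEigenEq {n : ℕ} (V : Space n → ℝ) (E : ℝ) (u : L2 n) : Prop :=
  ∀ φ : 𝓢(Space n, ℂ), ∫ x, u x * schrodinger V φ x = (E : ℂ) * ∫ x, u x * φ x

/-- The closed subspace of `L²` spanned by the bound states of `-(1/2) Δ + V`, that is, by the
eigenfunctions with negative eigenvalues. -/
def boundSpace {n : ℕ} (V : Space n → ℝ) : Submodule ℂ (L2 n) :=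
  (Submodule.span ℂ {u : L2 n | ∃ E : ℝ, E < 0 ∧ SolvesEigenEq V E u}).topologicalClosure

/-- `P_b(H)` for `H = -(1/2) Δ + V`: the orthogonal projection of `L²` onto the bound states. -/
def Pb {n : ℕ} (V : Space n → ℝ) : L2 n →L[ℂ] L2 n :=
  haveI : CompleteSpace (boundSpace V) := Submodule.topologicalClosure.completeSpace _
  (boundSpace V).starProjection

/-- The Galilei transform `e^{-i|v|²t/2} e^{-i x·v} e^{i t v·p}`, `p = -i∇`, on functions:
`f ↦ e^{-i|v|²t/2} e^{-i x·v} f(x + t v)`. -/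
def galileiFun {n : ℕ} (v : Space n) (t : ℝ) (f : Space n → ℂ) (x : Space n) : ℂ :=
  Complex.exp (-Complex.I * ((‖v‖ ^ 2 / 2 * t : ℝ) : ℂ)) *
    Complex.exp (-Complex.I * ((inner ℝ x v : ℝ) : ℂ)) * f (x + t • v)

theorem galileiFun_memLp {n : ℕ} (v : Space n) (t : ℝ) (f : L2 n) :
    MemLp (galileiFun v t f) 2 (volume : Measure (Space n)) := by
  have h1 : MemLp (fun x => f (x + t • v)) 2 (volume : Measure (Space n)) :=
    (Lp.memLp f).comp_measurePreserving (measurePreserving_add_right volume (t • v))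
  have hc : Continuous (fun x : Space n =>
      Complex.exp (-Complex.I * ((‖v‖ ^ 2 / 2 * t : ℝ) : ℂ)) *
        Complex.exp (-Complex.I * ((inner ℝ x v : ℝ) : ℂ))) := by
    fun_prop
  refine h1.of_le (hc.aestronglyMeasurable.mul h1.aestronglyMeasurable) (ae_of_all _ fun x => ?_)
  have key (r : ℝ) : ‖Complex.exp (-Complex.I * (r : ℂ))‖ = 1 := by
    simp [Complex.norm_exp]
  simp only [galileiFun, norm_mul, key, one_mul, le_refl]

/-- The Galilei transform `𝔤_v(t)` on `L²`. -/
def galilei {n : ℕ} (v : Space n) (t : ℝ) (f : L2 n) : L2 n :=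
  (galileiFun_memLp v t f).toLp (galileiFun v t f)

/-- `P_b(H₂, t) = 𝔤_{-e₁}(t) P_b(H₂) 𝔤_{e₁}(t)`: the projection onto the bound states of
`H₂ = -(1/2) Δ + V₂`, translated along with the potential `V₂(· - t e₁)`. -/
def PbMoving {n : ℕ} (V₂ : Space n → ℝ) (t : ℝ) (f : L2 n) : L2 n :=
  galilei (-e₁ n) t (Pb V₂ (galilei (e₁ n) t f))

/-- The total potential `V₁(x) + V₂(x - t e₁)` at time `t`. -/
def totalPotential {n : ℕ} (V₁ V₂ : Space n → ℝ) (t : ℝ) (x : Space n) : ℝ :=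
  V₁ x + V₂ (x - t • e₁ n)

/-- `ψ ∈ C([0, ∞); L²)` is the solution `ψ(t) = U(t) ψ₀` of the charge transfer equation
`(1/i) ∂_t ψ - (1/2) Δ ψ + V₁ ψ + V₂(· - t e₁) ψ = 0`, `ψ(0) = ψ₀`,
where the equation holds, for every `t ≥ 0`, in the sense of tempered distributions in `x`
(the time derivative is one-sided at `t = 0`). -/
structure IsSolution {n : ℕ} (V₁ V₂ : Space n → ℝ) (ψ₀ : L2 n) (ψ : ℝ → L2 n) : Prop where
  continuousOn : ContinuousOn ψ (Ici 0)
  initial : ψ 0 = ψ₀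
  equation : ∀ φ : 𝓢(Space n, ℂ), ∀ t : ℝ, 0 ≤ t →
    HasDerivWithinAt (fun s : ℝ => ∫ x, ψ s x * φ x)
      (-Complex.I * ∫ x, ψ t x * schrodinger (totalPotential V₁ V₂ t) φ x) (Ici 0) t

/-- `ψ` is asymptotically orthogonal to the bound states of `H₁` and `H₂`. -/
def AsymptoticallyOrthogonal {n : ℕ} (V₁ V₂ : Space n → ℝ) (ψ : ℝ → L2 n) : Prop :=
  Tendsto (fun t : ℝ => ‖Pb V₁ (ψ t)‖ + ‖PbMoving V₂ t (ψ t)‖) atTop (𝓝 0)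

end ChargeTransfer

end

noncomputable section

namespace ChargeTransfer

open scoped BoundedContinuousFunction LineDeriv InnerProductSpace ComplexConjugate

/-! Let u be a bound state of H₁ with eigenvalue E < 0. Along a solution, the time derivative of
e^{iEt}⟨u, ψ(t)⟩ is -i e^{iEt}⟨V₂(· - t e₁)u, ψ(t)⟩: the kinetic term and V₁ cancel against E, and
only the other potential is left. That potential lives in the half-space x₁ ≥ t - R, where u is
exponentially small, and ‖ψ(t)‖ is conserved, so the derivative is O(e^{-at}‖ψ₀‖). As the pairing
tends to zero, integrating from t to infinity shows that the pairing itself is O(e^{-at}‖ψ₀‖). Bound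
states of H₂ are treated in the same way after a Galilei transform to the frame where V₂ is at rest
and V₁ recedes in the direction -e₁. The constants are uniform because each H has only finitely many
independent bound states.

The ingredients are `exists_localization` (decay of bound states, by an energy estimate of Agmon
type), `finiteDimensional_negSpan` (finiteness, by a Poincaré inequality on small balls),
`IsWeakSol.norm_eq` (conservation of the norm, by Yosida regularization) and `IsWeakSol.galilei`
(covariance). The integration in time is `norm_inner_le_of_tendsto_zero`, and `exists_decay`
combines the estimates for one potential.

All equations are weak. The bridge to explicit computation is `exists_seq_graph_tendsto`: a weak
solution of the stationary equation is a limit of Schwartz functions in the graph norm, so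
identities and inequalities proved for Schwartz functions pass to the limit. -/

variable {n : ℕ}

/-! ### Schwartz functions as a dense subspace of L². -/

/-- The inclusion of the Schwartz space into `L²`. -/
def toL2 : 𝓢(Space n, ℂ) →ₗ[ℂ] L2 n :=
  (SchwartzMap.toLpCLM ℂ ℂ 2 (volume : Measure (Space n))).toLinearMap

theorem coeFn_toL2 (φ : 𝓢(Space n, ℂ)) : (toL2 φ : Space n → ℂ) =ᵐ[volume] φ :=
  φ.coeFn_toLp 2 volume

theorem denseRange_toL2 : DenseRange (toL2 : 𝓢(Space n, ℂ) → L2 n) :=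
  SchwartzMap.denseRange_toLpCLM (E := Space n) (F := ℂ) (p := 2) (by simp)

theorem exists_seq_toL2_tendsto (f : L2 n) :
    ∃ φ : ℕ → 𝓢(Space n, ℂ), Tendsto (fun k => toL2 (φ k)) atTop (𝓝 f) := by
  have h : f ∈ closure (range (toL2 : 𝓢(Space n, ℂ) → L2 n)) := denseRange_toL2 f
  obtain ⟨y, hy, hlim⟩ := mem_closure_iff_seq_limit.1 h
  choose φ hφ using hy
  exact ⟨φ, by simpa only [hφ] using hlim⟩

theorem eq_of_forall_inner_toL2 {f g : L2 n}
    (h : ∀ φ : 𝓢(Space n, ℂ), ⟪toL2 φ, f⟫_ℂ = ⟪toL2 φ, g⟫_ℂ) : f = g := by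
  refine ext_inner_left ℂ fun v => ?_
  exact denseRange_toL2.induction_on (p := fun v => ⟪v, f⟫_ℂ = ⟪v, g⟫_ℂ) v
    (isClosed_eq (by fun_prop) (by fun_prop)) h

/-- A vector whose pairings with Schwartz functions are bounded by `C` has norm at most `C`. -/
theorem norm_le_of_forall_inner_toL2 {f : L2 n} {C : ℝ} (hC : 0 ≤ C)
    (h : ∀ φ : 𝓢(Space n, ℂ), ‖⟪toL2 φ, f⟫_ℂ‖ ≤ C * ‖toL2 φ‖) : ‖f‖ ≤ C := by
  have h1 : ‖⟪f, f⟫_ℂ‖ ≤ C * ‖f‖ :=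
    denseRange_toL2.induction_on (p := fun v => ‖⟪v, f⟫_ℂ‖ ≤ C * ‖v‖) f
      (isClosed_le (by fun_prop) (by fun_prop)) h
  rw [inner_self_eq_norm_sq_to_K] at h1
  rcases (norm_nonneg f).eq_or_lt with hf | hf
  · rwa [← hf]
  · simp only [norm_pow, RCLike.norm_ofReal, abs_norm] at h1
    nlinarith

theorem inner_L2_eq_integral (f g : L2 n) : ⟪f, g⟫_ℂ = ∫ x, g x * conj (f x) := by
  rw [L2.inner_def]; rfl

theorem inner_toL2_left (φ : 𝓢(Space n, ℂ)) (g : L2 n) :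
    ⟪toL2 φ, g⟫_ℂ = ∫ x, g x * conj (φ x) := by
  rw [inner_L2_eq_integral]
  refine integral_congr_ae ?_
  filter_upwards [coeFn_toL2 φ] with x hx
  rw [hx]

/-! ### Conjugation and the kinetic operator on Schwartz functions. -/

/-- Pointwise complex conjugation of Schwartz functions. -/
def conjS (φ : 𝓢(Space n, ℂ)) : 𝓢(Space n, ℂ) :=
  φ.postcompCLM (Complex.conjCLE : ℂ →L[ℝ] ℂ)

@[simp] theorem conjS_apply (φ : 𝓢(Space n, ℂ)) (x : Space n) : conjS φ x = conj (φ x) := rfl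

@[simp] theorem conjS_conjS (φ : 𝓢(Space n, ℂ)) : conjS (conjS φ) = φ := by ext x; simp

theorem lineDeriv_conjS (φ : 𝓢(Space n, ℂ)) (v : Space n) : ∂_{v} (conjS φ) = conjS (∂_{v} φ) := by
  ext x
  rw [conjS_apply, SchwartzMap.lineDerivOp_apply_eq_fderiv, SchwartzMap.lineDerivOp_apply_eq_fderiv]
  have : (conjS φ : Space n → ℂ) = (Complex.conjCLE : ℂ →L[ℝ] ℂ) ∘ φ := rfl
  rw [this, ((Complex.conjCLE : ℂ →L[ℝ] ℂ).hasFDerivAt.comp x (φ.hasFDerivAt x)).fderiv]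
  rfl

theorem laplacian_conjS (φ : 𝓢(Space n, ℂ)) : Δ (conjS φ) = conjS (Δ φ) := by
  simp only [SchwartzMap.laplacian_eq_sum (EuclideanSpace.basisFun (Fin n) ℝ), lineDeriv_conjS]
  ext x
  simp

/-- The kinetic energy operator `-(1/2) Δ` on Schwartz functions. -/
def kinetic : 𝓢(Space n, ℂ) →ₗ[ℂ] 𝓢(Space n, ℂ) :=
  (-(1 / 2 : ℂ)) • (LineDeriv.laplacianCLM ℂ (Space n) 𝓢(Space n, ℂ)).toLinearMap

theorem kinetic_eq (φ : 𝓢(Space n, ℂ)) : kinetic φ = (-(1 / 2 : ℂ)) • Δ φ := by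
  simp [kinetic, SchwartzMap.laplacianCLM_eq]

theorem kinetic_apply (φ : 𝓢(Space n, ℂ)) (x : Space n) : kinetic φ x = -(1 / 2 : ℂ) * Δ φ x := by
  simp [kinetic_eq]

theorem kinetic_conjS (φ : 𝓢(Space n, ℂ)) : kinetic (conjS φ) = conjS (kinetic φ) := by
  ext x
  simp [kinetic_apply, laplacian_conjS, Complex.conj_ofNat]

/-! ### Multiplication operators and their quadratic forms. -/

theorem memLp_mul (W : Space n →ᵇ ℝ) (f : L2 n) :
    MemLp (fun x => (W x : ℂ) * f x) 2 (volume : Measure (Space n)) := by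
  refine (Lp.memLp f).of_le_mul (c := ‖W‖)
    ((Complex.continuous_ofReal.comp W.continuous).aestronglyMeasurable.mul
      (Lp.aestronglyMeasurable f)) (ae_of_all _ fun x => ?_)
  rw [norm_mul, Complex.norm_real]
  gcongr
  exact W.norm_coe_le_norm x

/-- Multiplication of `L²` functions by a bounded continuous real function. -/
def mulOp (W : Space n →ᵇ ℝ) : L2 n →L[ℂ] L2 n :=
  LinearMap.mkContinuous
    { toFun := fun f => (memLp_mul W f).toLp _
      map_add' := fun f g => by
        rw [← MemLp.toLp_add]
        refine MemLp.toLp_congr _ _ ?_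
        filter_upwards [Lp.coeFn_add f g] with x hx
        rw [hx, Pi.add_apply, Pi.add_apply, mul_add]
      map_smul' := fun c f => by
        rw [← MemLp.toLp_const_smul]
        refine MemLp.toLp_congr _ _ ?_
        filter_upwards [Lp.coeFn_smul c f] with x hx
        simp [hx]; ring } ‖W‖
    fun f => by
      refine Lp.norm_le_mul_norm_of_ae_le_mul ?_
      filter_upwards [(memLp_mul W f).coeFn_toLp] with x hx
      simp only [LinearMap.coe_mk, AddHom.coe_mk, hx, norm_mul, Complex.norm_real]
      gcongr
      exact W.norm_coe_le_norm x

theorem coeFn_mulOp (W : Space n →ᵇ ℝ) (f : L2 n) :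
    (mulOp W f : Space n → ℂ) =ᵐ[volume] fun x => (W x : ℂ) * f x :=
  (memLp_mul W f).coeFn_toLp

theorem norm_mulOp_apply_le (W : Space n →ᵇ ℝ) (f : L2 n) : ‖mulOp W f‖ ≤ ‖W‖ * ‖f‖ :=
  (mulOp W).le_of_opNorm_le (LinearMap.mkContinuous_norm_le _ (norm_nonneg _) _) f

theorem mulOp_sub (W Z : Space n →ᵇ ℝ) (f : L2 n) : mulOp (W - Z) f = mulOp W f - mulOp Z f := by
  apply Lp.ext
  filter_upwards [coeFn_mulOp (W - Z) f, coeFn_mulOp W f, coeFn_mulOp Z f,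
    Lp.coeFn_sub (mulOp W f) (mulOp Z f)] with x h1 h2 h3 h4
  rw [h4, Pi.sub_apply, h1, h2, h3]
  simp [sub_mul]

theorem inner_mulOp_left (W : Space n →ᵇ ℝ) (f g : L2 n) :
    ⟪mulOp W f, g⟫_ℂ = ⟪f, mulOp W g⟫_ℂ := by
  rw [inner_L2_eq_integral, inner_L2_eq_integral]
  refine integral_congr_ae ?_
  filter_upwards [coeFn_mulOp W f, coeFn_mulOp W g] with x h1 h2
  simp [h1, h2]; ring

/-- The quadratic form of a multiplication operator. -/
theorem re_inner_mulOp (W : Space n →ᵇ ℝ) (f : L2 n) :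
    (⟪f, mulOp W f⟫_ℂ).re = ∫ x, W x * ‖f x‖ ^ 2 := by
  have h : ⟪f, mulOp W f⟫_ℂ = ((∫ x, W x * ‖f x‖ ^ 2 : ℝ) : ℂ) := by
    rw [inner_L2_eq_integral, ← integral_complex_ofReal]
    refine integral_congr_ae ?_
    filter_upwards [coeFn_mulOp W f] with x h1
    rw [h1, mul_assoc, Complex.mul_conj, Complex.normSq_eq_norm_sq]
    push_cast; ring
  rw [h, Complex.ofReal_re]

theorem integrable_mul_norm_sq (W : Space n →ᵇ ℝ) (f : L2 n) :
    Integrable (fun x => W x * ‖f x‖ ^ 2) :=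
  (Lp.memLp f).integrable_norm_pow (by norm_num) |>.bdd_mul
    W.continuous.aestronglyMeasurable (ae_of_all _ W.norm_coe_le_norm)

theorem mulOp_mulOp (W Z : Space n →ᵇ ℝ) (f : L2 n) : mulOp W (mulOp Z f) = mulOp (W * Z) f := by
  apply Lp.ext
  filter_upwards [coeFn_mulOp (W * Z) f, coeFn_mulOp W (mulOp Z f), coeFn_mulOp Z f] with x h1 h2 h3
  simp [h1, h2, h3, mul_assoc]

theorem norm_mulOp_sq (W : Space n →ᵇ ℝ) (f : L2 n) :
    ‖mulOp W f‖ ^ 2 = (⟪f, mulOp (W * W) f⟫_ℂ).re := by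
  rw [← mulOp_mulOp, ← inner_mulOp_left, inner_self_eq_norm_sq_to_K]
  norm_cast

theorem mulOp_const (c : ℝ) (f : L2 n) :
    mulOp (BoundedContinuousFunction.const _ c) f = (c : ℂ) • f := by
  apply Lp.ext
  filter_upwards [coeFn_mulOp (BoundedContinuousFunction.const _ c) f, Lp.coeFn_smul (c : ℂ) f] with x h1 h2
  rw [h1, h2]
  simp

/-! ### Symmetry and positivity of the kinetic operator. -/

theorem inner_toL2_toL2 (φ η : 𝓢(Space n, ℂ)) :
    ⟪toL2 φ, toL2 η⟫_ℂ = ∫ x, conjS φ x * η x := by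
  rw [inner_toL2_left]
  refine integral_congr_ae ?_
  filter_upwards [coeFn_toL2 η] with x hx
  rw [hx, conjS_apply, mul_comm]

/-- Integration by parts. -/
theorem inner_lineDeriv_left (φ η : 𝓢(Space n, ℂ)) (v : Space n) :
    ⟪toL2 (∂_{v} φ), toL2 η⟫_ℂ = -⟪toL2 φ, toL2 (∂_{v} η)⟫_ℂ := by
  rw [inner_toL2_toL2, inner_toL2_toL2, SchwartzMap.integral_mul_lineDerivOp_right_eq_neg_left,
    neg_neg, lineDeriv_conjS]

/-- The kinetic energy operator is symmetric. -/
theorem inner_kinetic_left (φ η : 𝓢(Space n, ℂ)) :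
    ⟪toL2 (kinetic φ), toL2 η⟫_ℂ = ⟪toL2 φ, toL2 (kinetic η)⟫_ℂ := by
  rw [inner_toL2_toL2, inner_toL2_toL2, ← kinetic_conjS]
  simp only [kinetic_apply, mul_assoc, mul_left_comm _ (-(1 / 2 : ℂ)), integral_const_mul]
  rw [SchwartzMap.integral_mul_laplacian_right_eq_left]

theorem inner_kinetic_right (φ η : 𝓢(Space n, ℂ)) :
    ⟪toL2 φ, toL2 (kinetic η)⟫_ℂ =
      (1 / 2 : ℂ) * ∑ i, ⟪toL2 (∂_{EuclideanSpace.basisFun (Fin n) ℝ i} φ),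
        toL2 (∂_{EuclideanSpace.basisFun (Fin n) ℝ i} η)⟫_ℂ := by
  rw [kinetic_eq, SchwartzMap.laplacian_eq_sum (EuclideanSpace.basisFun (Fin n) ℝ), map_smul,
    inner_smul_right, map_sum, inner_sum]
  simp only [inner_lineDeriv_left, Finset.sum_neg_distrib]
  ring

theorem re_inner_kinetic (φ : 𝓢(Space n, ℂ)) :
    (⟪toL2 φ, toL2 (kinetic φ)⟫_ℂ).re =
      (1 / 2) * ∑ i, ‖toL2 (∂_{EuclideanSpace.basisFun (Fin n) ℝ i} φ)‖ ^ 2 := by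
  have h : ⟪toL2 φ, toL2 (kinetic φ)⟫_ℂ =
      (((1 / 2) * ∑ i, ‖toL2 (∂_{EuclideanSpace.basisFun (Fin n) ℝ i} φ)‖ ^ 2 : ℝ) : ℂ) := by
    rw [inner_kinetic_right]
    simp only [inner_self_eq_norm_sq_to_K]
    push_cast
    rfl
  rw [h, Complex.ofReal_re]

theorem re_inner_kinetic_nonneg (φ : 𝓢(Space n, ℂ)) :
    0 ≤ (⟪toL2 φ, toL2 (kinetic φ)⟫_ℂ).re := by
  rw [re_inner_kinetic]; positivity

/-! ### The free resolvent -/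

/-- Rescaling reduces this to a power of 1 + |x|². It makes the symbol of the free resolvent an
admissible multiplier on the Schwartz space. -/
theorem hasTemperateGrowth_inv_norm_sq_add {a b : ℝ} (ha : 0 < a) (hb : 0 < b) :
    (fun x : Space n => (a * ‖x‖ ^ 2 + b)⁻¹).HasTemperateGrowth := by
  have h0 : (fun x : Space n => √(a / b) • x).HasTemperateGrowth :=
    (√(a / b) • ContinuousLinearMap.id ℝ (Space n)).hasTemperateGrowth
  have h1 := (Function.HasTemperateGrowth.const b⁻¹ (E := Space n)).mul
    ((Function.hasTemperateGrowth_one_add_norm_sq_rpow (Space n) (-1)).comp h0)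
  suffices h : (fun x : Space n => (a * ‖x‖ ^ 2 + b)⁻¹) =
      (fun _ => b⁻¹) * ((fun x : Space n => (1 + ‖x‖ ^ 2) ^ (-1 : ℝ)) ∘ fun x => √(a / b) • x) by
    rw [h]; exact h1
  funext x
  have hx : (1 : ℝ) + a / b * ‖x‖ ^ 2 ≠ 0 := by positivity
  simp only [Pi.mul_apply, Function.comp_apply, norm_smul, Real.norm_eq_abs, mul_pow, sq_abs,
    Real.sq_sqrt (div_pos ha hb).le, Real.rpow_neg_one]
  rw [← mul_inv]
  congr 1
  field_simp
  ring

open FourierTransform in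
/-- The resolvent `(-(1/2) Δ + l)⁻¹` on Schwartz functions. -/
theorem exists_schwartz_resolvent {l : ℝ} (hl : 0 < l) :
    ∃ R : 𝓢(Space n, ℂ) →ₗ[ℂ] 𝓢(Space n, ℂ), ∀ φ, kinetic (R φ) + (l : ℂ) • R φ = φ := by
  -- With the Fourier kernel e^{-2πi x·ξ}, the symbol of -(1/2)Δ is 2π²|ξ|².
  have hg : (fun x : Space n => (2 * Real.pi ^ 2 * ‖x‖ ^ 2 + l)⁻¹).HasTemperateGrowth :=
    hasTemperateGrowth_inv_norm_sq_add (by positivity) hl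
  have hs : (fun x : Space n => ‖x‖ ^ 2).HasTemperateGrowth := by fun_prop
  let m : 𝓢(Space n, ℂ) →L[ℝ] 𝓢(Space n, ℂ) := SchwartzMap.fourierMultiplierCLM ℂ
    (fun x : Space n => (2 * Real.pi ^ 2 * ‖x‖ ^ 2 + l)⁻¹)
  let R : 𝓢(Space n, ℂ) →ₗ[ℂ] 𝓢(Space n, ℂ) := (SchwartzMap.fourierMultiplierCLM ℂ
    (fun x : Space n => (((2 * Real.pi ^ 2 * ‖x‖ ^ 2 + l)⁻¹ : ℝ) : ℂ))).toLinearMap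
  have hR : ∀ φ, R φ = m φ := fun φ => SchwartzMap.fourierMultiplierCLM_ofReal ℂ hg φ
  refine ⟨R, fun φ => ?_⟩
  rw [hR, kinetic_eq, SchwartzMap.laplacian_eq_fourierMultiplierCLM]
  simp only [m, SchwartzMap.fourierMultiplierCLM_apply, FourierTransform.fourier_fourierInv_eq]
  apply (FourierTransform.fourierEquiv ℂ 𝓢(Space n, ℂ)).injective
  have hsmul : ∀ (c : ℝ) (f : 𝓢(Space n, ℂ)), c • f = (c : ℂ) • f := fun c f => by
    ext x; simp
  simp only [FourierTransform.fourierEquiv_apply, FourierTransform.fourier_add,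
    FourierTransform.fourier_smul, FourierTransform.fourier_fourierInv_eq, hsmul]
  ext x
  have : 2 * (Real.pi : ℂ) ^ 2 * (‖x‖ : ℂ) ^ 2 + l ≠ 0 := by
    have : 2 * Real.pi ^ 2 * ‖x‖ ^ 2 + l ≠ 0 := by positivity
    exact_mod_cast this
  simp only [add_apply, smul_apply, SchwartzMap.smulLeftCLM_apply_apply hs,
    SchwartzMap.smulLeftCLM_apply_apply hg, Complex.real_smul, smul_eq_mul]
  push_cast
  field_simp

/-- Pair with φ: the kinetic form is nonnegative, and Cauchy–Schwarz removes one factor ‖φ‖. -/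
theorem mul_norm_toL2_le_of_kinetic_add (l : ℝ) (φ : 𝓢(Space n, ℂ)) :
    l * ‖toL2 φ‖ ≤ ‖toL2 (kinetic φ + (l : ℂ) • φ)‖ := by
  have h1 : l * ‖toL2 φ‖ ^ 2 ≤ (⟪toL2 φ, toL2 (kinetic φ + (l : ℂ) • φ)⟫_ℂ).re := by
    rw [map_add, map_smul, inner_add_right, inner_smul_right, inner_self_eq_norm_sq_to_K,
      Complex.add_re]
    have h2 := re_inner_kinetic_nonneg φ
    have h3 : ((l : ℂ) * ((‖toL2 φ‖ : ℝ) : ℂ) ^ 2).re = l * ‖toL2 φ‖ ^ 2 := by norm_cast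
    erw [h3]
    linarith
  have h2 := (h1.trans (Complex.re_le_norm _)).trans (norm_inner_le_norm _ _)
  rcases (norm_nonneg (toL2 φ)).eq_or_lt with h | h
  · rw [← h]; simp
  · nlinarith

/-- The resolvent `(-(1/2) Δ + l)⁻¹` on `L²`, characterized by its action on Schwartz functions. -/
theorem exists_resolvent {l : ℝ} (hl : 0 < l) :
    ∃ (R : 𝓢(Space n, ℂ) →ₗ[ℂ] 𝓢(Space n, ℂ)) (K : L2 n →L[ℂ] L2 n),
      (∀ φ, kinetic (R φ) + (l : ℂ) • R φ = φ) ∧ (∀ φ, K (toL2 φ) = toL2 (R φ)) ∧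
      (∀ f, l * ‖K f‖ ≤ ‖f‖) ∧ ∀ f g, ⟪K f, g⟫_ℂ = ⟪f, K g⟫_ℂ := by
  obtain ⟨R, hR⟩ := exists_schwartz_resolvent (n := n) hl
  have hb : ∀ φ, ‖(toL2 ∘ₗ R) φ‖ ≤ l⁻¹ * ‖toL2 φ‖ := fun φ => by
    have := mul_norm_toL2_le_of_kinetic_add l (R φ)
    rw [hR] at this
    rw [inv_mul_eq_div, le_div_iff₀' hl]
    exact this
  have hK : ∀ φ, (toL2 ∘ₗ R).extendOfNorm toL2 (toL2 φ) = toL2 (R φ) := fun φ =>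
    LinearMap.extendOfNorm_eq denseRange_toL2 ⟨l⁻¹, hb⟩ φ
  refine ⟨R, (toL2 ∘ₗ R).extendOfNorm toL2, hR, hK, fun f => ?_, fun f g => ?_⟩
  · have := LinearMap.norm_extendOfNorm_apply_le denseRange_toL2 l⁻¹ hb f
    rwa [inv_mul_eq_div, le_div_iff₀' hl] at this
  · refine denseRange_toL2.induction_on₂ (p := fun f g => ⟪(toL2 ∘ₗ R).extendOfNorm toL2 f, g⟫_ℂ =
      ⟪f, (toL2 ∘ₗ R).extendOfNorm toL2 g⟫_ℂ) (isClosed_eq (by fun_prop) (by fun_prop)) ?_ f g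
    intro φ η
    rw [hK, hK]
    conv_lhs => rw [← hR η]
    conv_rhs => rw [← hR φ]
    rw [map_add, map_add, inner_add_right, inner_add_left, ← inner_kinetic_left, map_smul, map_smul,
      inner_smul_left, inner_smul_right, Complex.conj_ofReal]

/-- A weak solution `u ∈ L²` of `-(1/2) Δ u = g ∈ L²` is the limit of Schwartz functions in the
graph norm of `-(1/2) Δ`. -/
theorem exists_seq_graph_tendsto {u g : L2 n}
    (h : ∀ φ : 𝓢(Space n, ℂ), ⟪toL2 (kinetic φ), u⟫_ℂ = ⟪toL2 φ, g⟫_ℂ) :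
    ∃ f : ℕ → 𝓢(Space n, ℂ), Tendsto (fun k => toL2 (f k)) atTop (𝓝 u) ∧
      Tendsto (fun k => toL2 (kinetic (f k))) atTop (𝓝 g) := by
  obtain ⟨R, K, hR, hK, -, hKs⟩ := exists_resolvent (n := n) one_pos
  obtain ⟨φ, hφ⟩ := exists_seq_toL2_tendsto (g + u)
  -- With T the kinetic operator, u = (T + 1)⁻¹(g + u) holds weakly, so applying the resolvent to
  -- Schwartz approximations of g + u approximates u and Tu together.
  have hKu : K (g + u) = u := by
    refine eq_of_forall_inner_toL2 fun η => ?_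
    rw [← hKs, hK, inner_add_right, ← h, ← inner_add_left, ← map_add]
    conv_rhs => rw [← hR η]
    simp
  have h1 : Tendsto (fun k => toL2 (R (φ k))) atTop (𝓝 u) := by
    have := (K.continuous.tendsto _).comp hφ
    rw [hKu] at this
    simpa only [Function.comp_def, hK] using this
  refine ⟨fun k => R (φ k), h1, ?_⟩
  have h2 := hφ.sub h1
  rw [add_sub_cancel_right] at h2
  refine h2.congr fun k => ?_
  rw [← map_sub]
  congr 1
  rw [sub_eq_iff_eq_add]
  simpa using (hR (φ k)).symm

/-! ### Potentials and weak equations -/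

theorem IsPotential.continuous {V : Space n → ℝ} (hV : IsPotential V) : Continuous V :=
  hV.lipschitz.choose_spec.continuous

/-- A potential as a bounded continuous function. -/
def IsPotential.toBCF {V : Space n → ℝ} (hV : IsPotential V) : Space n →ᵇ ℝ :=
  BoundedContinuousFunction.ofNormedAddCommGroup V hV.continuous
    (hV.compactSupport.exists_bound_of_continuous hV.continuous).choose
    (hV.compactSupport.exists_bound_of_continuous hV.continuous).choose_spec

@[simp] theorem IsPotential.toBCF_apply {V : Space n → ℝ} (hV : IsPotential V) (x : Space n) :
    hV.toBCF x = V x := rfl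

theorem IsPotential.exists_support_bound {V : Space n → ℝ} (hV : IsPotential V) :
    ∃ R : ℝ, 0 ≤ R ∧ ∀ x, V x ≠ 0 → ‖x‖ ≤ R := by
  obtain ⟨R, hR⟩ := hV.compactSupport.isCompact.isBounded.subset_closedBall 0
  exact ⟨max R 0, le_max_right _ _, fun x hx =>
    le_max_of_le_left (by simpa using hR (subset_tsupport V hx))⟩

/-- The translate `x ↦ W (x - a)`. -/
def translateBCF (W : Space n →ᵇ ℝ) (a : Space n) : Space n →ᵇ ℝ :=
  W.compContinuous ⟨fun x => x - a, by fun_prop⟩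

@[simp] theorem translateBCF_apply (W : Space n →ᵇ ℝ) (a x : Space n) :
    translateBCF W a x = W (x - a) := rfl

theorem norm_translateBCF_le (W : Space n →ᵇ ℝ) (a : Space n) : ‖translateBCF W a‖ ≤ ‖W‖ :=
  W.norm_compContinuous_le _

/-- The definitions test against φ bilinearly, while the inner product is conjugate-linear in its
first slot. Conjugating φ passes from one to the other. -/
theorem inner_kinetic_add_mulOp (W : Space n →ᵇ ℝ) (φ : 𝓢(Space n, ℂ)) (g : L2 n) :
    ⟪toL2 (kinetic φ) + mulOp W (toL2 φ), g⟫_ℂ = ∫ x, g x * schrodinger W (conjS φ) x := by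
  rw [inner_L2_eq_integral]
  refine integral_congr_ae ?_
  filter_upwards [Lp.coeFn_add (toL2 (kinetic φ)) (mulOp W (toL2 φ)), coeFn_toL2 (kinetic φ),
    coeFn_mulOp W (toL2 φ), coeFn_toL2 φ] with x h1 h2 h3 h4
  rw [h1, Pi.add_apply, h2, h3, h4, schrodinger, laplacian_conjS, conjS_apply, conjS_apply,
    kinetic_apply]
  simp [Complex.conj_ofNat]

/-- Weak solutions `ψ` of `i ∂ₜ ψ = (-(1/2) Δ + W(t)) ψ` on `[0, ∞)`. -/
def IsWeakSol (W : ℝ → Space n →ᵇ ℝ) (ψ : ℝ → L2 n) : Prop :=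
  ∀ φ : 𝓢(Space n, ℂ), ∀ t : ℝ, 0 ≤ t → HasDerivWithinAt (fun s => ⟪toL2 φ, ψ s⟫_ℂ)
    (-Complex.I * ⟪toL2 (kinetic φ) + mulOp (W t) (toL2 φ), ψ t⟫_ℂ) (Ici 0) t

/-- `u ∈ L²` satisfies `(-(1/2) Δ + W) u = g` weakly. -/
def IsWeakEq (W : Space n →ᵇ ℝ) (u g : L2 n) : Prop :=
  ∀ φ : 𝓢(Space n, ℂ), ⟪toL2 (kinetic φ) + mulOp W (toL2 φ), u⟫_ℂ = ⟪toL2 φ, g⟫_ℂ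

theorem IsSolution.isWeakSol {V₁ V₂ : Space n → ℝ} (hV₁ : IsPotential V₁) (hV₂ : IsPotential V₂)
    {ψ₀ : L2 n} {ψ : ℝ → L2 n} (h : IsSolution V₁ V₂ ψ₀ ψ) :
    IsWeakSol (fun t => hV₁.toBCF + translateBCF hV₂.toBCF (t • e₁ n)) ψ := by
  intro φ t ht
  have := h.equation (conjS φ) t ht
  rw [inner_kinetic_add_mulOp]
  simp only [inner_toL2_left]
  exact this

theorem SolvesEigenEq.isWeakEq {V : Space n → ℝ} (hV : IsPotential V) {E : ℝ} {u : L2 n}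
    (h : SolvesEigenEq V E u) : IsWeakEq hV.toBCF u ((E : ℂ) • u) := by
  intro φ
  rw [inner_kinetic_add_mulOp, inner_smul_right, inner_toL2_left]
  exact h (conjS φ)

/-- Approximation in the graph norm. -/
theorem IsWeakEq.exists_seq {W : Space n →ᵇ ℝ} {u g : L2 n} (h : IsWeakEq W u g) :
    ∃ f : ℕ → 𝓢(Space n, ℂ), Tendsto (fun k => toL2 (f k)) atTop (𝓝 u) ∧
      Tendsto (fun k => toL2 (kinetic (f k))) atTop (𝓝 (g - mulOp W u)) := by
  refine exists_seq_graph_tendsto fun φ => ?_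
  rw [inner_sub_right, ← h φ, inner_add_left, inner_mulOp_left]
  ring

/-- Weak solutions are limits of Schwartz functions in the graph norm, so the operator is symmetric
on them. Orthogonality of eigenspaces rests on this. -/
theorem IsWeakEq.symm_inner {W : Space n →ᵇ ℝ} {u g v h : L2 n} (hu : IsWeakEq W u g)
    (hv : IsWeakEq W v h) : ⟪g, v⟫_ℂ = ⟪u, h⟫_ℂ := by
  obtain ⟨f, hf, hTf⟩ := hu.exists_seq
  have h1 : Tendsto (fun k => ⟪toL2 (kinetic (f k)) + mulOp W (toL2 (f k)), v⟫_ℂ) atTop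
      (𝓝 ⟪g - mulOp W u + mulOp W u, v⟫_ℂ) :=
    (hTf.add (((mulOp W).continuous.tendsto _).comp hf)).inner tendsto_const_nhds
  have h2 : Tendsto (fun k => ⟪toL2 (f k), h⟫_ℂ) atTop (𝓝 ⟪u, h⟫_ℂ) :=
    hf.inner tendsto_const_nhds
  rw [sub_add_cancel] at h1
  exact tendsto_nhds_unique h1 (h2.congr fun k => (hv (f k)).symm)

/-! ### Exponential localization of bound states -/

theorem re_inner_mulOp_le_mul {W Z : Space n →ᵇ ℝ} {c : ℝ} (h : ∀ x, Z x ≤ c * W x) (f : L2 n) :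
    (⟪f, mulOp Z f⟫_ℂ).re ≤ c * (⟪f, mulOp W f⟫_ℂ).re := by
  rw [re_inner_mulOp, re_inner_mulOp, ← integral_const_mul]
  refine integral_mono (integrable_mul_norm_sq Z f) ((integrable_mul_norm_sq W f).const_mul c)
    fun x => ?_
  simpa [mul_assoc] using mul_le_mul_of_nonneg_right (h x) (by positivity : (0 : ℝ) ≤ ‖f x‖ ^ 2)

theorem re_inner_mulOp_le_of_le {Z : Space n →ᵇ ℝ} {c : ℝ} (h : ∀ x, Z x ≤ c) (f : L2 n) :
    (⟪f, mulOp Z f⟫_ℂ).re ≤ c * ‖f‖ ^ 2 := by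
  have := re_inner_mulOp_le_mul (W := BoundedContinuousFunction.const _ 1) (Z := Z) (c := c)
    (by simpa using h) f
  rw [mulOp_const, Complex.ofReal_one, one_smul, inner_self_eq_norm_sq_to_K] at this
  exact_mod_cast this

/-- Since σ' = σ(1 - σ), every derivative is a polynomial in σ, hence bounded because σ takes values
in [0, 1]. -/
theorem iteratedDeriv_sigmoid (k : ℕ) :
    ∃ Q : Polynomial ℝ, iteratedDeriv k Real.sigmoid = fun x => Q.eval (Real.sigmoid x) := by
  induction k with
  | zero => exact ⟨Polynomial.X, by simp⟩
  | succ k ih =>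
    obtain ⟨Q, hQ⟩ := ih
    refine ⟨Polynomial.derivative Q * (Polynomial.X * (1 - Polynomial.X)), ?_⟩
    rw [iteratedDeriv_succ, hQ]
    funext x
    refine ((Q.hasDerivAt (Real.sigmoid x)).comp x (Real.hasDerivAt_sigmoid x)).deriv.trans ?_
    simp

theorem hasTemperateGrowth_sigmoid : Real.sigmoid.HasTemperateGrowth := by
  refine ⟨contDiff_sigmoid.of_le (by simp), fun k => ?_⟩
  obtain ⟨Q, hQ⟩ := iteratedDeriv_sigmoid k
  obtain ⟨C, hC⟩ := (isCompact_Icc (a := (0 : ℝ)) (b := 1)).exists_bound_of_continuousOn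
    (f := fun y => Q.eval y) Q.continuous.continuousOn
  refine ⟨0, C, fun x => ?_⟩
  rw [norm_iteratedFDeriv_eq_norm_iteratedDeriv, hQ, pow_zero, mul_one]
  exact hC _ ⟨Real.sigmoid_nonneg x, Real.sigmoid_le_one x⟩

theorem toL2_smulLeftCLM {p : Space n →ᵇ ℝ} (hp : (p : Space n → ℝ).HasTemperateGrowth)
    (f : 𝓢(Space n, ℂ)) : toL2 (SchwartzMap.smulLeftCLM ℂ p f) = mulOp p (toL2 f) := by
  apply Lp.ext
  filter_upwards [coeFn_toL2 (SchwartzMap.smulLeftCLM ℂ p f), coeFn_mulOp p (toL2 f),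
    coeFn_toL2 f] with x h1 h2 h3
  rw [h1, h2, h3, SchwartzMap.smulLeftCLM_apply_apply hp, Complex.real_smul]

/-- Energy estimate with a positive slowly varying weight. -/
theorem weighted_energy {p : Space n →ᵇ ℝ} (hp : (p : Space n → ℝ).HasTemperateGrowth)
    (hpos : ∀ x, 0 ≤ p x) {a : ℝ} (ha : 0 ≤ a)
    (hd : ∀ x v, |fderiv ℝ p x v| ≤ 2 * a * p x * ‖v‖) (f : 𝓢(Space n, ℂ)) :
    -(n / 2 * a ^ 2) * (⟪toL2 f, mulOp p (toL2 f)⟫_ℂ).re ≤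
      (⟪mulOp p (toL2 f), toL2 (kinetic f)⟫_ℂ).re := by
  set b := EuclideanSpace.basisFun (Fin n) ℝ
  -- One coordinate direction at a time; the n directions and the factor 1/2 in the kinetic form
  -- produce n a²/2.
  have hint : ∀ i, -a ^ 2 * (⟪toL2 f, mulOp p (toL2 f)⟫_ℂ).re ≤
      (⟪toL2 (∂_{b i} (SchwartzMap.smulLeftCLM ℂ p f)), toL2 (∂_{b i} f)⟫_ℂ).re := by
    intro i
    rw [inner_toL2_toL2, re_inner_mulOp, ← integral_const_mul]
    have hI : Integrable (fun x => conjS (∂_{b i} (SchwartzMap.smulLeftCLM ℂ p f)) x * ∂_{b i} f x) :=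
      (SchwartzMap.integrable (∂_{b i} f)).bdd_mul
        (SchwartzMap.continuous _).aestronglyMeasurable
        (ae_of_all _ (SchwartzMap.norm_le_seminorm ℂ _))
    have h2 : (∫ x, conjS (∂_{b i} (SchwartzMap.smulLeftCLM ℂ p f)) x * ∂_{b i} f x).re =
        ∫ x, (conjS (∂_{b i} (SchwartzMap.smulLeftCLM ℂ p f)) x * ∂_{b i} f x).re :=
      (integral_re hI).symm
    rw [h2]
    refine integral_mono_ae ((integrable_mul_norm_sq p (toL2 f)).const_mul _) hI.re ?_
    filter_upwards [coeFn_toL2 f] with x hx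
    rw [hx]
    have hder : ∂_{b i} (SchwartzMap.smulLeftCLM ℂ p f) x =
        (fderiv ℝ p x (b i) : ℂ) * f x + (p x : ℂ) * ∂_{b i} f x := by
      rw [SchwartzMap.lineDerivOp_apply_eq_fderiv, SchwartzMap.lineDerivOp_apply_eq_fderiv]
      have h3 : (SchwartzMap.smulLeftCLM ℂ p f : Space n → ℂ) = fun x => p x • f x := by
        funext y; rw [SchwartzMap.smulLeftCLM_apply_apply hp]
      rw [h3, fderiv_fun_smul ((hp.1.differentiable (by simp)) x) f.differentiableAt]
      simp; ring
    rw [conjS_apply, hder]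
    have hdi := hd x (b i)
    rw [b.orthonormal.1 i, mul_one] at hdi
    set z := ∂_{b i} f x
    set w := f x
    set q := fderiv ℝ p x (b i)
    have hre : (conj ((q : ℂ) * w + (p x : ℂ) * z) * z).re =
        q * (conj w * z).re + p x * ‖z‖ ^ 2 := by
      have : conj ((q : ℂ) * w + (p x : ℂ) * z) * z = q * (conj w * z) + p x * (conj z * z) := by
        simp; ring
      rw [this, Complex.add_re, Complex.re_ofReal_mul, Complex.re_ofReal_mul,
        Complex.conj_mul', ← Complex.ofReal_pow, Complex.ofReal_re]
    rw [hre]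
    have h4 : |q * (conj w * z).re| ≤ 2 * a * p x * (‖w‖ * ‖z‖) := by
      rw [abs_mul]
      have : |(conj w * z).re| ≤ ‖w‖ * ‖z‖ := by
        refine (Complex.abs_re_le_norm _).trans ?_
        rw [norm_mul, RCLike.norm_conj]
      exact mul_le_mul hdi this (abs_nonneg _) (mul_nonneg (by positivity) (hpos x))
    have h5 := neg_le_of_abs_le h4
    -- Completing the square: p|z|² - 2ap|w||z| ≥ -a²p|w|².
    nlinarith [mul_nonneg (hpos x) (sq_nonneg (a * ‖w‖ - ‖z‖))]
  rw [← toL2_smulLeftCLM hp, inner_kinetic_right, toL2_smulLeftCLM hp]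
  have h6 : ((1 / 2 : ℂ) * ∑ i, ⟪toL2 (∂_{b i} (SchwartzMap.smulLeftCLM ℂ p f)),
      toL2 (∂_{b i} f)⟫_ℂ).re = (1 / 2) * ∑ i, (⟪toL2 (∂_{b i} (SchwartzMap.smulLeftCLM ℂ p f)),
      toL2 (∂_{b i} f)⟫_ℂ).re := by
    rw [show (1 / 2 : ℂ) = ((1 / 2 : ℝ) : ℂ) by push_cast; rfl, Complex.re_ofReal_mul,
      Complex.re_sum]
  rw [h6]
  have h7 := Finset.sum_le_sum fun i (_ : i ∈ Finset.univ) => hint i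
  simp only [Finset.sum_const, Finset.card_univ, Fintype.card_fin, nsmul_eq_mul] at h7
  linarith

theorem mulOp_neg (W : Space n →ᵇ ℝ) (f : L2 n) : mulOp (-W) f = -mulOp W f := by
  apply Lp.ext
  filter_upwards [coeFn_mulOp (-W) f, coeFn_mulOp W f, Lp.coeFn_neg (mulOp W f)] with x h1 h2 h3
  rw [h3, Pi.neg_apply, h1, h2]
  simp

/-- The weight `x ↦ sigmoid (2 a (⟪v, x⟫ - s))`. -/
def sigmoidWeight (a s : ℝ) (v : Space n) : Space n →ᵇ ℝ :=
  BoundedContinuousFunction.ofNormedAddCommGroup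
    (fun x => Real.sigmoid (2 * a * (⟪v, x⟫_ℝ - s))) (by fun_prop) 1 fun x => by
      rw [Real.norm_eq_abs, abs_of_nonneg (Real.sigmoid_nonneg _)]
      exact Real.sigmoid_le_one _

theorem sigmoidWeight_apply (a s : ℝ) (v x : Space n) :
    sigmoidWeight a s v x = Real.sigmoid (2 * a * (⟪v, x⟫_ℝ - s)) := rfl

theorem hasTemperateGrowth_sigmoidWeight (a s : ℝ) (v : Space n) :
    (sigmoidWeight a s v : Space n → ℝ).HasTemperateGrowth :=
  hasTemperateGrowth_sigmoid.comp
    (f := fun x : Space n => 2 * a * (⟪v, x⟫_ℝ - s)) (by fun_prop)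

/-- From σ' = σ(1 - σ) ≤ σ. The weight grows like an exponential at rate 2a while small, yet it is
bounded, so it acts on L² without truncation. -/
theorem abs_fderiv_sigmoidWeight_le {a : ℝ} (ha : 0 ≤ a) (s : ℝ) {v : Space n} (hv : ‖v‖ ≤ 1)
    (x y : Space n) :
    |fderiv ℝ (sigmoidWeight a s v) x y| ≤ 2 * a * sigmoidWeight a s v x * ‖y‖ := by
  have h1 : HasFDerivAt (fun x : Space n => 2 * a * (⟪v, x⟫_ℝ - s))
      ((2 * a) • innerSL ℝ v) x :=
    ((innerSL ℝ v).hasFDerivAt.sub_const s).const_mul (2 * a)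
  have h2 := (Real.hasDerivAt_sigmoid (2 * a * (⟪v, x⟫_ℝ - s))).comp_hasFDerivAt x h1
  have h3 : fderiv ℝ (sigmoidWeight a s v) x = _ := h2.fderiv
  rw [h3, sigmoidWeight_apply]
  set q := Real.sigmoid (2 * a * (⟪v, x⟫_ℝ - s)) with hq
  have hq0 : 0 ≤ q := Real.sigmoid_nonneg _
  have hq1 : q ≤ 1 := Real.sigmoid_le_one _
  have h4 : |⟪v, y⟫_ℝ| ≤ ‖y‖ := (abs_real_inner_le_norm v y).trans
    (mul_le_of_le_one_left (norm_nonneg _) hv)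
  simp only [smul_apply, innerSL_apply_apply, smul_eq_mul, abs_mul, abs_of_nonneg hq0,
    abs_of_nonneg (sub_nonneg.2 hq1), abs_of_nonneg ha, abs_two]
  calc q * (1 - q) * (2 * a * |⟪v, y⟫_ℝ|) ≤ q * 1 * (2 * a * ‖y‖) := by
        gcongr; linarith
    _ = _ := by ring

/-- Eigenfunctions with negative eigenvalues are exponentially small in far away half-spaces. -/
theorem exists_localization {V : Space n →ᵇ ℝ} {R : ℝ} (hR : ∀ x, V x ≠ 0 → ‖x‖ ≤ R)
    {E : ℝ} (hE : E < 0) {u : L2 n} (hu : IsWeakEq V u ((E : ℂ) • u)) {v : Space n}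
    (hv : ‖v‖ ≤ 1) :
    ∃ a : ℝ, 0 < a ∧ ∃ C : ℝ, 0 ≤ C ∧ ∀ (s : ℝ) (Z : Space n →ᵇ ℝ),
      (∀ x, Z x ≠ 0 → s ≤ ⟪v, x⟫_ℝ) → ‖mulOp Z u‖ ≤ C * Real.exp (-a * s) * ‖Z‖ := by
  -- The rate is chosen so that the loss n a²/2 in the energy estimate is at most half of -E; n + 1
  -- avoids division by zero.
  set a : ℝ := √(-E / (n + 1)) with ha
  have hapos : 0 < a := Real.sqrt_pos.2 (div_pos (neg_pos.2 hE) (by positivity))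
  have hasq : n * a ^ 2 ≤ -E := by
    rw [ha, Real.sq_sqrt (div_pos (neg_pos.2 hE) (by positivity)).le, mul_div_assoc',
      div_le_iff₀ (by positivity)]
    nlinarith
  obtain ⟨f, hf, hTf⟩ := hu.exists_seq
  refine ⟨a, hapos, √(4 / (-E) * ‖V‖) * Real.exp (a * R) * ‖u‖, by positivity, fun s Z hZ => ?_⟩
  set p := sigmoidWeight a s v with hp
  have hpT : (p : Space n → ℝ).HasTemperateGrowth := hasTemperateGrowth_sigmoidWeight a s v
  have hp0 : ∀ x, 0 ≤ p x := fun x => Real.sigmoid_nonneg _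
  have hmul := fun (W : Space n →ᵇ ℝ) => ((mulOp W).continuous.tendsto _).comp hf
  -- In the limit the kinetic term becomes (E - V)u, so (-E/2)⟨u, pu⟩ ≤ ⟨u, -pVu⟩: the weighted mass
  -- is controlled by the support of V alone.
  have hlim := le_of_tendsto_of_tendsto'
    (((Complex.continuous_re.tendsto _).comp (hf.inner (hmul p))).const_mul (-(n / 2 * a ^ 2)))
    ((Complex.continuous_re.tendsto _).comp ((hmul p).inner hTf))
    fun k => weighted_energy hpT hp0 hapos.le (abs_fderiv_sigmoidWeight_le hapos.le s hv) (f k)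
  have h1 : (⟪mulOp p u, (E : ℂ) • u - mulOp V u⟫_ℂ).re =
      E * (⟪u, mulOp p u⟫_ℂ).re + (⟪u, mulOp (p * -V) u⟫_ℂ).re := by
    rw [inner_mulOp_left, map_sub, inner_sub_right, map_smul, inner_smul_right, ← mulOp_mulOp, mulOp_neg,
      map_neg, inner_neg_right, Complex.sub_re, Complex.re_ofReal_mul, Complex.neg_re,
      sub_eq_add_neg]
  rw [h1] at hlim
  -- On the support of V one has ⟪v, x⟫ ≤ R, and σ(y) ≤ e^y makes the weight exponentially small in
  -- s there.
  have hpV : ∀ x, (p * -V) x ≤ Real.exp (2 * a * (R - s)) * ‖V‖ := by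
    intro x
    by_cases hx : V x = 0
    · simp [hx]; positivity
    · have h3 : p x ≤ Real.exp (2 * a * (R - s)) := by
        have h4 : ⟪v, x⟫_ℝ ≤ R := (real_inner_le_norm v x).trans
          ((mul_le_of_le_one_left (norm_nonneg _) hv).trans (hR x hx))
        have h5 : ∀ y : ℝ, Real.sigmoid y ≤ Real.exp y := fun y => by
          rw [Real.sigmoid_def, ← neg_neg y, Real.exp_neg (-y), neg_neg]
          gcongr
          linarith [Real.exp_pos (-y)]
        refine (h5 _).trans (Real.exp_le_exp.2 ?_)
        gcongr
      have h6 : -V x ≤ ‖V‖ := (neg_le_abs _).trans (V.norm_coe_le_norm x)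
      show p x * -V x ≤ _
      calc p x * -V x ≤ p x * ‖V‖ := mul_le_mul_of_nonneg_left h6 (hp0 x)
        _ ≤ _ := by gcongr
  have h7 := re_inner_mulOp_le_of_le hpV u
  -- Where Z is nonzero the argument of the sigmoid is nonnegative, so the weight is at least 1/2.
  have hZp : ∀ x, (Z * Z) x ≤ (2 * ‖Z‖ ^ 2) * p x := by
    intro x
    by_cases hx : Z x = 0
    · simp only [BoundedContinuousFunction.mul_apply, hx, mul_zero]
      exact mul_nonneg (by positivity) (hp0 x)
    · have h8 : 1 / 2 ≤ p x := by
        rw [one_div, ← Real.sigmoid_zero]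
        exact Real.sigmoid_le (mul_nonneg (by positivity) (sub_nonneg.2 (hZ x hx)))
      have h9 : Z x * Z x ≤ ‖Z‖ ^ 2 := by
        rw [← sq, sq_le_sq, abs_norm]
        exact Z.norm_coe_le_norm x
      show Z x * Z x ≤ _
      nlinarith [sq_nonneg ‖Z‖]
  have h10 := re_inner_mulOp_le_mul hZp u
  rw [← norm_mulOp_sq] at h10
  have hq : 0 ≤ (⟪u, mulOp p u⟫_ℂ).re := by
    rw [re_inner_mulOp]
    exact integral_nonneg fun x => mul_nonneg (hp0 x) (by positivity)
  have h11 : (⟪u, mulOp p u⟫_ℂ).re ≤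
      2 / (-E) * (Real.exp (2 * a * (R - s)) * ‖V‖ * ‖u‖ ^ 2) := by
    rw [div_mul_eq_mul_div, le_div_iff₀ (neg_pos.2 hE)]
    nlinarith
  refine (pow_le_pow_iff_left₀ (norm_nonneg _) (by positivity) two_ne_zero).1 ?_
  have h12 : Real.exp (2 * a * (R - s)) = (Real.exp (a * R) * Real.exp (-a * s)) ^ 2 := by
    rw [← Real.exp_add, ← Real.exp_nat_mul]
    congr 1
    push_cast
    ring
  rw [mul_pow, mul_pow, mul_pow, mul_pow, Real.sq_sqrt (mul_nonneg (div_nonneg (by norm_num)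
    (neg_pos.2 hE).le) (norm_nonneg _))]
  calc ‖mulOp Z u‖ ^ 2 ≤ 2 * ‖Z‖ ^ 2 * (⟪u, mulOp p u⟫_ℂ).re := h10
    _ ≤ 2 * ‖Z‖ ^ 2 * (2 / (-E) * (Real.exp (2 * a * (R - s)) * ‖V‖ * ‖u‖ ^ 2)) := by gcongr
    _ = _ := by rw [h12]; ring

section

/-! ### Translations -/

open scoped ENNReal

/-- The Cauchy-Schwarz inequality against the constant function. -/
theorem sq_lintegral_le {α : Type*} [MeasurableSpace α] (μ : Measure α) {f : α → ℝ≥0∞}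
    (hf : AEMeasurable f μ) : (∫⁻ x, f x ∂μ) ^ 2 ≤ μ univ * ∫⁻ x, f x ^ 2 ∂μ := by
  have h := ENNReal.lintegral_mul_le_Lp_mul_Lq μ Real.HolderConjugate.two_two
    (aemeasurable_const (b := (1 : ℝ≥0∞))) hf
  simp only [Pi.mul_apply, one_mul, ENNReal.one_rpow, lintegral_one] at h
  calc (∫⁻ x, f x ∂μ) ^ 2 ≤ (μ univ ^ (1 / 2 : ℝ) * (∫⁻ x, f x ^ (2 : ℝ) ∂μ) ^ (1 / 2 : ℝ)) ^ 2 := by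
        gcongr
    _ = _ := by
        rw [mul_pow, ← ENNReal.rpow_natCast, ← ENNReal.rpow_natCast, ← ENNReal.rpow_mul,
          ← ENNReal.rpow_mul]
        simp

theorem enorm_sq_L2 (f : L2 n) : ‖f‖ₑ ^ 2 = ∫⁻ x, ‖f x‖ₑ ^ 2 := by
  rw [Lp.enorm_def, eLpNorm_eq_lintegral_rpow_enorm_toReal (by simp) (by simp), ← ENNReal.rpow_natCast,
    ← ENNReal.rpow_mul]
  simp

theorem enorm_sq_toL2 (f : 𝓢(Space n, ℂ)) : ‖toL2 f‖ₑ ^ 2 = ∫⁻ x, ‖f x‖ₑ ^ 2 := by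
  rw [enorm_sq_L2]
  refine lintegral_congr_ae ?_
  filter_upwards [coeFn_toL2 f] with x hx
  rw [hx]

/-- Minkowski's inequality for averages over `[0, 1]`. -/
theorem lintegral_enorm_sq_average_le {G : ℝ → Space n → ℂ} (hG : Continuous (Function.uncurry G))
    {h : Space n → ℂ} (hh : ∀ x, h x = ∫ s in (0 : ℝ)..1, G s x) {C : ℝ≥0∞}
    (hC : ∀ s ∈ Icc (0 : ℝ) 1, ∫⁻ x, ‖G s x‖ₑ ^ 2 ≤ C) : ∫⁻ x, ‖h x‖ₑ ^ 2 ≤ C := by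
  have h1 : ∀ x, ‖h x‖ₑ ^ 2 ≤ ∫⁻ s in Ioc (0 : ℝ) 1, ‖G s x‖ₑ ^ 2 := by
    intro x
    have hc : Continuous fun s => G s x := hG.comp (by fun_prop : Continuous fun s : ℝ => (s, x))
    rw [hh x, intervalIntegral.integral_of_le zero_le_one]
    calc _ ≤ (∫⁻ s in Ioc (0 : ℝ) 1, ‖G s x‖ₑ) ^ 2 := by
          gcongr; exact enorm_integral_le_lintegral_enorm _
      _ ≤ _ := (sq_lintegral_le _ hc.enorm.measurable.aemeasurable).trans (by simp)
  calc ∫⁻ x, ‖h x‖ₑ ^ 2 ≤ ∫⁻ x, ∫⁻ s in Ioc (0 : ℝ) 1, ‖G s x‖ₑ ^ 2 := lintegral_mono h1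
    _ = ∫⁻ s in Ioc (0 : ℝ) 1, ∫⁻ x, ‖G s x‖ₑ ^ 2 := by
        refine lintegral_lintegral_swap ?_
        have : Continuous fun z : Space n × ℝ => ‖G z.2 z.1‖ₑ ^ 2 :=
          ((ENNReal.continuous_pow 2).comp continuous_enorm).comp
            (hG.comp (by fun_prop : Continuous fun z : Space n × ℝ => (z.2, z.1)))
        exact this.measurable.aemeasurable
    _ ≤ ∫⁻ _ in Ioc (0 : ℝ) 1, C := by
        refine setLIntegral_mono measurable_const fun s hs => hC s ⟨hs.1.le, hs.2⟩
    _ = C := by simp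

/-- Translation `f ↦ f (· + y)` on `L²`. -/
def translate (y : Space n) : L2 n →ₗᵢ[ℂ] L2 n :=
  Lp.compMeasurePreservingₗᵢ ℂ (fun x => x + y) (measurePreserving_add_right volume y)

theorem coeFn_translate (y : Space n) (f : L2 n) :
    (translate y f : Space n → ℂ) =ᵐ[volume] fun x => f (x + y) :=
  Lp.coeFn_compMeasurePreserving f (measurePreserving_add_right volume y)

/-- Translation `f ↦ f (· + y)` on the Schwartz space. -/
def translateS (y : Space n) (f : 𝓢(Space n, ℂ)) : 𝓢(Space n, ℂ) :=
  SchwartzMap.compSubConstCLM ℂ (-y) f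

@[simp] theorem translateS_apply (y : Space n) (f : 𝓢(Space n, ℂ)) (x : Space n) :
    translateS y f x = f (x + y) := by
  simp [translateS]

theorem translate_toL2 (y : Space n) (f : 𝓢(Space n, ℂ)) :
    translate y (toL2 f) = toL2 (translateS y f) := by
  apply Lp.ext
  filter_upwards [coeFn_translate y (toL2 f), coeFn_toL2 (translateS y f),
    (measurePreserving_add_right volume y).quasiMeasurePreserving.ae_eq (coeFn_toL2 f)]
    with x h1 h2 h3
  rw [h1, h2, translateS_apply]
  exact h3

theorem hasDerivAt_schwartz_line (f : 𝓢(Space n, ℂ)) (x y : Space n) (s : ℝ) :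
    HasDerivAt (fun s : ℝ => f (x + s • y)) (∂_{y} f (x + s • y)) s := by
  rw [SchwartzMap.lineDerivOp_apply_eq_fderiv]
  have h1 : HasDerivAt (fun s : ℝ => x + s • y) y s := by
    simpa using ((hasDerivAt_id s).smul_const y).const_add x
  exact (f.hasFDerivAt (x + s • y)).comp_hasDerivAt s h1

theorem schwartz_translate_sub (f : 𝓢(Space n, ℂ)) (x y : Space n) :
    f (x + y) - f x = ∫ s in (0 : ℝ)..1, ∂_{y} f (x + s • y) := by
  have := intervalIntegral.integral_eq_sub_of_hasDerivAt
    (fun s _ => hasDerivAt_schwartz_line f x y s)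
    (Continuous.intervalIntegrable (by fun_prop) (0 : ℝ) 1)
  rw [this]; simp

theorem enorm_le_of_lintegral_sq_le {f g : 𝓢(Space n, ℂ)}
    (h : ∫⁻ x, ‖f x‖ₑ ^ 2 ≤ ‖toL2 g‖ₑ ^ 2) : ‖toL2 f‖ ≤ ‖toL2 g‖ := by
  rw [← enorm_sq_toL2] at h
  rw [← ofReal_norm, ← ofReal_norm, ← ENNReal.ofReal_pow (norm_nonneg _),
    ← ENNReal.ofReal_pow (norm_nonneg _), ENNReal.ofReal_le_ofReal_iff (by positivity)] at h
  exact (pow_le_pow_iff_left₀ (norm_nonneg _) (norm_nonneg _) two_ne_zero).1 h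

theorem norm_toL2_translateS (y : Space n) (f : 𝓢(Space n, ℂ)) :
    ‖toL2 (translateS y f)‖ = ‖toL2 f‖ := by
  rw [← translate_toL2, LinearIsometry.norm_map]

/-- The increment is the average over s in [0, 1] of translates of ∂_y f, all of the same norm;
Minkowski's inequality applies. -/
theorem norm_toL2_translateS_sub_le (y : Space n) (f : 𝓢(Space n, ℂ)) :
    ‖toL2 (translateS y f - f)‖ ≤ ‖toL2 (∂_{y} f)‖ := by
  refine enorm_le_of_lintegral_sq_le ?_
  refine lintegral_enorm_sq_average_le (G := fun s x => ∂_{y} f (x + s • y)) (by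
    unfold Function.uncurry; fun_prop) (fun x => ?_) fun s _ => ?_
  · rw [← schwartz_translate_sub]; simp
  · have := enorm_sq_toL2 (translateS (s • y) (∂_{y} f))
    simp only [translateS_apply] at this
    rw [← this]
    exact le_of_eq (by rw [← ofReal_norm, norm_toL2_translateS, ofReal_norm])

theorem norm_sq_lineDeriv_le (y : Space n) (f : 𝓢(Space n, ℂ)) :
    ‖toL2 (∂_{y} f)‖ ^ 2 ≤ ‖y‖ ^ 2 * (2 * (⟪toL2 f, toL2 (kinetic f)⟫_ℂ).re) := by
  set b := EuclideanSpace.basisFun (Fin n) ℝ with hb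
  have h1 : ∂_{y} f = ∑ i, (y i : ℂ) • ∂_{b i} f := by
    ext x
    simp only [SchwartzMap.lineDerivOp_apply_eq_fderiv, sum_apply, smul_apply]
    conv_lhs => rw [← b.sum_repr y]
    simp [hb]
  have h2 : ‖toL2 (∂_{y} f)‖ ≤ ∑ i, ‖y i‖ * ‖toL2 (∂_{b i} f)‖ := by
    rw [h1, map_sum]
    refine (norm_sum_le _ _).trans (Finset.sum_le_sum fun i _ => ?_)
    rw [map_smul, norm_smul, Complex.norm_real]
  calc _ ≤ (∑ i, ‖y i‖ * ‖toL2 (∂_{b i} f)‖) ^ 2 := by gcongr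
    _ ≤ (∑ i, ‖y i‖ ^ 2) * ∑ i, ‖toL2 (∂_{b i} f)‖ ^ 2 := Finset.sum_mul_sq_le_sq_mul_sq _ _ _
    _ = _ := by rw [re_inner_kinetic, EuclideanSpace.norm_sq_eq]; ring

/-- The kinetic energy bounds the L² modulus of continuity. This replaces a gradient bound for u, so
no weak derivatives of u are needed. -/
theorem norm_sq_translate_sub_le {u g : L2 n}
    (h : ∀ φ : 𝓢(Space n, ℂ), ⟪toL2 (kinetic φ), u⟫_ℂ = ⟪toL2 φ, g⟫_ℂ) (y : Space n) :
    ‖translate y u - u‖ ^ 2 ≤ ‖y‖ ^ 2 * (2 * (⟪u, g⟫_ℂ).re) := by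
  obtain ⟨f, hf, hTf⟩ := exists_seq_graph_tendsto h
  refine le_of_tendsto_of_tendsto'
    (((((translate y).continuous.tendsto _).comp hf).sub hf).norm.pow 2)
    ((((Complex.continuous_re.tendsto _).comp (hf.inner hTf)).const_mul 2).const_mul (‖y‖ ^ 2))
    fun k => ?_
  simp only [Function.comp_apply]
  rw [translate_toL2, ← map_sub]
  exact (pow_le_pow_left₀ (norm_nonneg _) (norm_toL2_translateS_sub_le y (f k)) 2).trans
    (norm_sq_lineDeriv_le y (f k))

/-! ### Finiteness of the number of bound states -/

open Metric

/-- When the mean vanishes, |ball| · u(x) = -∫ (u(z) - u(x)) dz over the ball. Cauchy–Schwarz gives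
the square, and every such z lies within 2r of x. -/
theorem enorm_sq_le_of_setIntegral_eq_zero {u : L2 n} {c : Space n} {r : ℝ} (hr : 0 < r)
    (hu : ∫ x in ball c r, u x = 0) {x : Space n} (hx : x ∈ ball c r) :
    ‖u x‖ₑ ^ 2 ≤ (volume (ball (0 : Space n) r))⁻¹ *
      ∫⁻ y in ball (0 : Space n) (2 * r), ‖u (x + y) - u x‖ₑ ^ 2 := by
  have hmeas : Measurable (u : Space n → ℂ) := (Lp.stronglyMeasurable u).measurable
  have hvol : volume (ball c r) = volume (ball (0 : Space n) r) :=
    Measure.addHaar_ball_center _ _ _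
  have hv0 : volume (ball (0 : Space n) r) ≠ 0 := (measure_ball_pos _ _ hr).ne'
  have hvt : volume (ball (0 : Space n) r) ≠ ∞ := measure_ball_lt_top.ne
  have hint : IntegrableOn u (ball c r) :=
    (Lp.memLp u).locallyIntegrable (by norm_num) |>.integrableOn_isCompact
      (isCompact_closedBall c r) |>.mono_set ball_subset_closedBall
  have h1 : ∫ z in ball c r, (u z - u x) = -((volume.real (ball c r) : ℂ) * u x) := by
    rw [integral_sub hint (integrableOn_const (by rw [hvol]; exact hvt)), hu, zero_sub, setIntegral_const]
    simp
  have h2 : volume (ball (0 : Space n) r) * ‖u x‖ₑ ≤ ∫⁻ z in ball c r, ‖u z - u x‖ₑ := by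
    have h3 : ‖∫ z in ball c r, (u z - u x)‖ₑ = volume (ball (0 : Space n) r) * ‖u x‖ₑ := by
      rw [h1, enorm_neg, enorm_mul, measureReal_def, hvol, ← ofReal_norm (Complex.ofReal _),
        Complex.norm_real, Real.norm_of_nonneg ENNReal.toReal_nonneg, ENNReal.ofReal_toReal hvt]
    rw [← h3]
    exact enorm_integral_le_lintegral_enorm _
  have h4 : (volume (ball (0 : Space n) r) * ‖u x‖ₑ) ^ 2 ≤
      volume (ball (0 : Space n) r) * ∫⁻ z in ball c r, ‖u z - u x‖ₑ ^ 2 := by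
    refine (pow_le_pow_left' h2 2).trans ?_
    refine (sq_lintegral_le _ (hmeas.sub_const _).enorm.aemeasurable).trans ?_
    rw [Measure.restrict_apply_univ, hvol]
  have h5 : ∫⁻ z in ball c r, ‖u z - u x‖ₑ ^ 2 ≤
      ∫⁻ y in ball (0 : Space n) (2 * r), ‖u (x + y) - u x‖ₑ ^ 2 := by
    rw [← lintegral_indicator measurableSet_ball, ← lintegral_indicator measurableSet_ball,
      ← lintegral_add_left_eq_self _ x]
    refine lintegral_mono fun y => ?_
    by_cases hy : x + y ∈ ball c r
    · have hy' : y ∈ ball (0 : Space n) (2 * r) := by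
        rw [mem_ball_zero_iff]
        have : y = (x + y) - x := by simp
        rw [this, ← dist_eq_norm]
        calc _ ≤ dist (x + y) c + dist x c := dist_triangle_right _ _ _
          _ < r + r := add_lt_add hy hx
          _ = 2 * r := by ring
      rw [indicator_of_mem hy, indicator_of_mem hy']
    · rw [indicator_of_notMem hy]; simp
  rw [mul_pow, sq (volume _), mul_assoc] at h4
  have h6 := (ENNReal.mul_le_mul_iff_right hv0 hvt).1 h4
  rw [mul_comm, ← div_eq_mul_inv, ENNReal.le_div_iff_mul_le (Or.inl hv0) (Or.inl hvt), mul_comm]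
  exact h6.trans h5

/-- A local Poincaré inequality: if the averages of `u` over balls covering `B` vanish, then `u` is
controlled on `B` by its `L²` modulus of continuity. -/
theorem setLIntegral_le_of_translate_sub_le {u : L2 n} {G : ℝ}
    (hG : ∀ y, ‖translate y u - u‖ ^ 2 ≤ ‖y‖ ^ 2 * G) (hG0 : 0 ≤ G) {r : ℝ} (hr : 0 < r)
    {B t : Set (Space n)} (hB : B ⊆ ⋃ c ∈ t, ball c r)
    (hu : ∀ c ∈ t, ∫ x in ball c r, u x = 0) :
    ∫⁻ x in B, ‖u x‖ₑ ^ 2 ≤ ENNReal.ofReal (2 ^ n * (2 * r) ^ 2 * G) := by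
  have hmeas : Measurable (u : Space n → ℂ) := (Lp.stronglyMeasurable u).measurable
  have hv0 : volume (ball (0 : Space n) r) ≠ 0 := (measure_ball_pos _ _ hr).ne'
  have hvt : volume (ball (0 : Space n) r) ≠ ∞ := measure_ball_lt_top.ne
  set v := volume (ball (0 : Space n) r)
  have h2r : volume (ball (0 : Space n) (2 * r)) = ENNReal.ofReal (2 ^ n) * v := by
    rw [Measure.addHaar_ball_mul_of_pos volume 0 (by norm_num) r]
    simp [v]
  have hm : Measurable fun z : Space n × Space n => ‖u (z.1 + z.2) - u z.1‖ₑ ^ 2 :=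
    (((hmeas.comp (measurable_fst.add measurable_snd)).sub (hmeas.comp measurable_fst)).enorm).pow_const 2
  calc ∫⁻ x in B, ‖u x‖ₑ ^ 2
      ≤ ∫⁻ x in B, v⁻¹ * ∫⁻ y in ball (0 : Space n) (2 * r), ‖u (x + y) - u x‖ₑ ^ 2 := by
        refine setLIntegral_mono (Measurable.const_mul (Measurable.lintegral_prod_right hm) _) ?_
        intro x hx
        obtain ⟨c, hc, hxc⟩ := mem_iUnion₂.1 (hB hx)
        exact enorm_sq_le_of_setIntegral_eq_zero hr (hu c hc) hxc
    -- Once x ranges over the whole space, Tonelli turns the inner integral into ‖translate y u -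
    -- u‖² with |y| < 2r. The factor 2^n is the ratio of the volumes of the two balls.
    _ ≤ ∫⁻ x, v⁻¹ * ∫⁻ y in ball (0 : Space n) (2 * r), ‖u (x + y) - u x‖ₑ ^ 2 :=
        setLIntegral_le_lintegral _ _
    _ = v⁻¹ * ∫⁻ y in ball (0 : Space n) (2 * r), ∫⁻ x, ‖u (x + y) - u x‖ₑ ^ 2 := by
        rw [lintegral_const_mul' _ _ (ENNReal.inv_ne_top.2 hv0),
          lintegral_lintegral_swap hm.aemeasurable]
    _ ≤ v⁻¹ * ∫⁻ _ in ball (0 : Space n) (2 * r), ENNReal.ofReal ((2 * r) ^ 2 * G) := by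
        refine mul_le_mul_right ?_ _
        refine setLIntegral_mono measurable_const fun y hy => ?_
        have h1 : ∫⁻ x, ‖u (x + y) - u x‖ₑ ^ 2 = ‖translate y u - u‖ₑ ^ 2 := by
          rw [enorm_sq_L2]
          refine lintegral_congr_ae ?_
          filter_upwards [Lp.coeFn_sub (translate y u) u, coeFn_translate y u] with x h1 h2
          rw [h1, Pi.sub_apply, h2]
        rw [h1, ← ofReal_norm, ← ENNReal.ofReal_pow (norm_nonneg _)]
        refine ENNReal.ofReal_le_ofReal ((hG y).trans ?_)
        have : ‖y‖ ≤ 2 * r := (mem_ball_zero_iff.1 hy).le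
        gcongr
    _ = _ := by
        have h3 : ENNReal.ofReal (2 ^ n * (2 * r) ^ 2 * G) =
            ENNReal.ofReal (2 ^ n) * ENNReal.ofReal ((2 * r) ^ 2 * G) := by
          rw [mul_assoc, ENNReal.ofReal_mul (by positivity)]
        rw [setLIntegral_const, h2r, h3]
        calc v⁻¹ * (ENNReal.ofReal ((2 * r) ^ 2 * G) * (ENNReal.ofReal (2 ^ n) * v))
            = v⁻¹ * v * (ENNReal.ofReal (2 ^ n) * ENNReal.ofReal ((2 * r) ^ 2 * G)) := by ring
          _ = _ := by rw [ENNReal.inv_mul_cancel hv0 hvt, one_mul]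

end

section

/-! ### Finite dimension of the space of bound states -/

open Metric
open scoped ENNReal

/-- The eigenspace of `-(1/2) Δ + V` in `L²`. -/
def eigenSubmodule (V : Space n →ᵇ ℝ) (E : ℝ) : Submodule ℂ (L2 n) where
  carrier := {u | IsWeakEq V u ((E : ℂ) • u)}
  add_mem' := fun {u v} hu hv φ => by
    rw [inner_add_right, hu φ, hv φ, smul_add, inner_add_right]
  zero_mem' := fun φ => by simp
  smul_mem' := fun c u hu φ => by
    rw [inner_smul_right, hu φ, smul_comm, inner_smul_right _ _ c]

theorem inner_eq_zero_of_mem_eigenSubmodule {V : Space n →ᵇ ℝ} {E F : ℝ} (hEF : E ≠ F)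
    {u v : L2 n} (hu : u ∈ eigenSubmodule V E) (hv : v ∈ eigenSubmodule V F) : ⟪u, v⟫_ℂ = 0 := by
  have h := IsWeakEq.symm_inner hu hv
  rw [inner_smul_left, inner_smul_right, Complex.conj_ofReal] at h
  have h2 : ((E : ℂ) - F) * ⟪u, v⟫_ℂ = 0 := by rw [sub_mul, h, sub_self]
  exact (mul_eq_zero.1 h2).resolve_left (sub_ne_zero.2 (by exact_mod_cast hEF))

/-- The algebraic span of the bound states. -/
def negSpan (V : Space n →ᵇ ℝ) : Submodule ℂ (L2 n) :=
  ⨆ E : {E : ℝ // E < 0}, eigenSubmodule V E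

/-- The Hamiltonian is negative definite on the span of the bound states. -/
theorem exists_isWeakEq_of_mem_negSpan {V : Space n →ᵇ ℝ} {u : L2 n} (hu : u ∈ negSpan V) :
    ∃ h, IsWeakEq V u h ∧ (⟪u, h⟫_ℂ).re ≤ 0 ∧ (0 ≤ (⟪u, h⟫_ℂ).re → u = 0) := by
  obtain ⟨f, hf, rfl⟩ := (Submodule.mem_iSup_iff_exists_finsupp _ _).1 hu
  refine ⟨∑ i ∈ f.support, (((i : ℝ) : ℂ)) • f i, fun φ => ?_, ?_⟩
  · rw [Finsupp.sum, inner_sum, inner_sum]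
    exact Finset.sum_congr rfl fun i _ => hf i φ
  · have h1 : (⟪f.sum fun _ x => x, ∑ i ∈ f.support, (((i : ℝ) : ℂ)) • f i⟫_ℂ).re =
        ∑ i ∈ f.support, (i : ℝ) * ‖f i‖ ^ 2 := by
      rw [Finsupp.sum, sum_inner, Complex.re_sum]
      refine Finset.sum_congr rfl fun i hi => ?_
      rw [inner_sum, Finset.sum_eq_single_of_mem i hi]
      · rw [inner_smul_right, inner_self_eq_norm_sq_to_K, Complex.re_ofReal_mul]
        norm_cast
      · intro j _ hij
        rw [inner_smul_right, inner_eq_zero_of_mem_eigenSubmodule (E := i) (F := j)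
          (fun h => hij (Subtype.ext h.symm)) (hf i) (hf j), mul_zero]
    have h2 : ∀ i ∈ f.support, (i : ℝ) * ‖f i‖ ^ 2 ≤ 0 := fun i _ =>
      mul_nonpos_of_nonpos_of_nonneg i.2.le (by positivity)
    rw [h1]
    refine ⟨Finset.sum_nonpos h2, fun h3 => ?_⟩
    have h4 := (Finset.sum_eq_zero_iff_of_nonpos h2).1 (le_antisymm (Finset.sum_nonpos h2) h3)
    refine Finset.sum_eq_zero fun i hi => ?_
    have := (mul_eq_zero.1 (h4 i hi)).resolve_left i.2.ne
    simpa using this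

/-- Negativity of the Hamiltonian bounds twice the kinetic energy, G, by 2‖V‖ times the mass b of u
on B, while the local Poincaré inequality bounds b by a small multiple of G. The smallness of r
forces b = 0. Then V contributes nothing, the energy of u is purely kinetic and hence nonnegative,
and definiteness gives u = 0. -/
theorem eq_zero_of_mem_negSpan {V : Space n →ᵇ ℝ} {B : Set (Space n)} (hBm : MeasurableSet B)
    (hVB : ∀ x, V x ≠ 0 → x ∈ B) {r : ℝ} (hr : 0 < r)
    (hsmall : 2 ^ n * (2 * r) ^ 2 * (2 * ‖V‖) < 1) {t : Set (Space n)}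
    (hB : B ⊆ ⋃ c ∈ t, ball c r) {u : L2 n} (hu : u ∈ negSpan V)
    (hz : ∀ c ∈ t, ∫ x in ball c r, u x = 0) : u = 0 := by
  obtain ⟨h, huh, hneg, hzero⟩ := exists_isWeakEq_of_mem_negSpan hu
  have hw : ∀ φ : 𝓢(Space n, ℂ), ⟪toL2 (kinetic φ), u⟫_ℂ = ⟪toL2 φ, h - mulOp V u⟫_ℂ := by
    intro φ
    rw [inner_sub_right, ← huh φ, inner_add_left, inner_mulOp_left]
    ring
  set G : ℝ := 2 * (⟪u, h - mulOp V u⟫_ℂ).re with hGdef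
  have hG0 : 0 ≤ G := by
    obtain ⟨f, hf, hTf⟩ := exists_seq_graph_tendsto hw
    have := ge_of_tendsto' ((Complex.continuous_re.tendsto _).comp (hf.inner hTf))
      fun k => re_inner_kinetic_nonneg (f k)
    simp only [hGdef]; linarith
  have hint : Integrable (fun x => ‖u x‖ ^ 2) := (Lp.memLp u).integrable_norm_pow (by norm_num)
  set b : ℝ := ∫ x in B, ‖u x‖ ^ 2 with hb
  have hb0 : 0 ≤ b := integral_nonneg fun x => by positivity
  have hVb : |(⟪u, mulOp V u⟫_ℂ).re| ≤ ‖V‖ * b := by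
    rw [re_inner_mulOp, hb, ← integral_indicator hBm, ← integral_const_mul, ← Real.norm_eq_abs]
    refine norm_integral_le_of_norm_le ((hint.indicator hBm).const_mul _) (ae_of_all _ fun x => ?_)
    by_cases hx : V x = 0
    · rw [hx, zero_mul, norm_zero]
      exact mul_nonneg (norm_nonneg _) (indicator_nonneg (fun _ _ => by positivity) _)
    · rw [indicator_of_mem (hVB x hx), norm_mul, norm_pow, norm_norm]
      gcongr
      exact V.norm_coe_le_norm x
  have hGb : G ≤ 2 * ‖V‖ * b := by
    rw [hGdef, inner_sub_right, Complex.sub_re]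
    have := neg_le_of_abs_le hVb
    linarith
  have hbG : b ≤ 2 ^ n * (2 * r) ^ 2 * G := by
    have h1 := setLIntegral_le_of_translate_sub_le (fun y => norm_sq_translate_sub_le hw y) hG0 hr hB hz
    have h2 : b = (∫⁻ x in B, ‖u x‖ₑ ^ 2).toReal := by
      rw [hb, integral_eq_lintegral_of_nonneg_ae (ae_of_all _ fun x => by positivity)
        hint.aestronglyMeasurable.restrict]
      congr 1
      refine lintegral_congr fun x => ?_
      rw [ENNReal.ofReal_pow (norm_nonneg _), ofReal_norm]
    rw [h2]
    exact ENNReal.toReal_le_of_le_ofReal (by positivity) h1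
  have hbz : b = 0 := by
    by_contra hne
    have hbpos : 0 < b := lt_of_le_of_ne hb0 (Ne.symm hne)
    have h1 : b ≤ 2 ^ n * (2 * r) ^ 2 * (2 * ‖V‖ * b) := hbG.trans (by gcongr)
    nlinarith
  refine hzero ?_
  rw [hbz, mul_zero] at hVb
  have hV0 : (⟪u, mulOp V u⟫_ℂ).re = 0 := abs_eq_zero.1 (le_antisymm hVb (abs_nonneg _))
  rw [hGdef, inner_sub_right, Complex.sub_re, hV0] at hG0
  linarith

/-- A compactly supported potential has only finitely many bound states. -/
theorem finiteDimensional_negSpan {V : Space n →ᵇ ℝ} {R : ℝ} (hR : ∀ x, V x ≠ 0 → ‖x‖ ≤ R) :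
    FiniteDimensional ℂ (negSpan V) := by
  obtain ⟨r, hr, hsmall⟩ : ∃ r : ℝ, 0 < r ∧ 2 ^ n * (2 * r) ^ 2 * (2 * ‖V‖) < 1 := by
    have hc : Tendsto (fun r : ℝ => 2 ^ n * (2 * r) ^ 2 * (2 * ‖V‖)) (𝓝[>] 0) (𝓝 0) := by
      have : Continuous (fun r : ℝ => 2 ^ n * (2 * r) ^ 2 * (2 * ‖V‖)) := by fun_prop
      exact ((this.tendsto' 0 0 (by simp)).mono_left nhdsWithin_le_nhds)
    obtain ⟨r, hr1, hr2⟩ := ((hc.eventually_lt_const one_pos).and self_mem_nhdsWithin).exists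
    exact ⟨r, hr2, hr1⟩
  obtain ⟨t, -, htf, ht⟩ := finite_cover_balls_of_compact (isCompact_closedBall (0 : Space n) R) hr
  have := htf.fintype
  -- The averages over the finitely many covering balls (up to normalization) determine an element
  -- of the span, so their number bounds its dimension.
  let L : L2 n →ₗ[ℂ] (t → ℂ) := LinearMap.pi fun c =>
    (innerSL ℂ (indicatorConstLp 2 (measurableSet_ball (x := (c : Space n)) (ε := r))
      measure_ball_lt_top.ne (1 : ℂ))).toLinearMap
  have hL : ∀ u c, L u c = ∫ x in ball (c : Space n) r, u x := fun u c =>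
    L2.inner_indicatorConstLp_one _ _ _
  refine FiniteDimensional.of_injective (L ∘ₗ (negSpan V).subtype) ?_
  rw [← LinearMap.ker_eq_bot, LinearMap.ker_eq_bot']
  rintro ⟨u, hu⟩ hLu
  refine Subtype.ext (eq_zero_of_mem_negSpan measurableSet_closedBall
    (fun x hx => mem_closedBall_zero_iff.2 (hR x hx)) hr hsmall ht hu fun c hc => ?_)
  rw [← hL u ⟨c, hc⟩]
  exact congrFun hLu _

theorem span_eigenfunctions_le_negSpan {V : Space n → ℝ} (hV : IsPotential V) :
    Submodule.span ℂ {u : L2 n | ∃ E : ℝ, E < 0 ∧ SolvesEigenEq V E u} ≤ negSpan hV.toBCF := by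
  rw [Submodule.span_le]
  rintro u ⟨E, hE, hu⟩
  exact Submodule.mem_iSup_of_mem (⟨E, hE⟩ : {E : ℝ // E < 0}) (hu.isWeakEq hV)

/-- The bound states are spanned by finitely many eigenfunctions. -/
theorem exists_finite_eigenfunctions {V : Space n → ℝ} (hV : IsPotential V) :
    ∃ (ι : Type) (_ : Fintype ι) (u : ι → L2 n) (E : ι → ℝ) (C : ℝ), 0 ≤ C ∧
      (∀ i, E i < 0 ∧ IsWeakEq hV.toBCF (u i) ((E i : ℂ) • u i)) ∧
      (∀ f i, ‖⟪u i, f⟫_ℂ‖ ≤ ‖u i‖ * ‖Pb V f‖) ∧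
      ∀ f, ‖Pb V f‖ ≤ C * ∑ i, ‖⟪u i, f⟫_ℂ‖ := by
  obtain ⟨R, -, hR⟩ := hV.exists_support_bound
  have hfin : FiniteDimensional ℂ (negSpan hV.toBCF) := finiteDimensional_negSpan hR
  set S := {u : L2 n | ∃ E : ℝ, E < 0 ∧ SolvesEigenEq V E u} with hS
  have hfin' : FiniteDimensional ℂ (Submodule.span ℂ S) :=
    Submodule.finiteDimensional_of_le (span_eigenfunctions_le_negSpan hV)
  obtain ⟨s, hsS, hspan⟩ := Submodule.fg_span_iff_fg_span_finset_subset S |>.1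
    ((Submodule.fg_iff_finiteDimensional _).2 hfin')
  have hB : boundSpace V = Submodule.span ℂ (s : Set (L2 n)) := by
    rw [boundSpace, ← hS, (Submodule.closed_of_finiteDimensional _).submodule_topologicalClosure_eq,
      hspan]
  have hBfin : FiniteDimensional ℂ (boundSpace V) := by rw [hB, ← hspan]; exact hfin'
  have hBc : CompleteSpace (boundSpace V) := Submodule.topologicalClosure.completeSpace _
  have hmem : ∀ u : s, (u : L2 n) ∈ boundSpace V := fun u => by
    rw [hB]; exact Submodule.subset_span u.2
  have hinner : ∀ (u : s) (f : L2 n), ⟪(u : L2 n), f⟫_ℂ = ⟪(u : L2 n), Pb V f⟫_ℂ := fun u f => by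
    rw [Pb, ← Submodule.inner_starProjection_left_eq_right,
      Submodule.starProjection_eq_self_iff.2 (hmem u)]
  -- The spanning eigenfunctions need not be orthonormal. The map to the pairings is injective on a
  -- finite-dimensional space, hence bounded below, and this gives the constant.
  let T : boundSpace V →ₗ[ℂ] (s → ℂ) :=
    LinearMap.pi fun u => (innerSL ℂ (u : L2 n)).toLinearMap ∘ₗ (boundSpace V).subtype
  have hT : LinearMap.ker T = ⊥ := by
    rw [LinearMap.ker_eq_bot']
    intro w hw
    have h0 : ∀ v ∈ boundSpace V, ⟪v, (w : L2 n)⟫_ℂ = 0 := by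
      intro v hv
      rw [hB] at hv
      induction hv using Submodule.span_induction with
      | mem v hv => exact congrFun hw ⟨v, hv⟩
      | zero => simp
      | add a b _ _ ha hb => rw [inner_add_left, ha, hb, add_zero]
      | smul c a _ ha => rw [inner_smul_left, ha, mul_zero]
    exact Subtype.ext (inner_self_eq_zero.1 (h0 w w.2))
  obtain ⟨K, -, hK⟩ := LinearMap.exists_antilipschitzWith T hT
  choose E hE using fun u : s => hsS u.2
  refine ⟨s, inferInstance, fun u => u, E, K, K.2, fun u => ⟨(hE u).1, (hE u).2.isWeakEq hV⟩,
    fun f u => ?_, fun f => ?_⟩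
  · rw [hinner]
    exact norm_inner_le_norm _ _
  · have hP : Pb V f ∈ boundSpace V := Submodule.starProjection_apply_mem _ f
    have h1 := ZeroHomClass.bound_of_antilipschitz T hK ⟨Pb V f, hP⟩
    refine h1.trans ?_
    gcongr
    refine (pi_norm_le_iff_of_nonneg (by positivity)).2 fun u => ?_
    have h2 : T ⟨Pb V f, hP⟩ u = ⟪(u : L2 n), f⟫_ℂ := (hinner u f).symm
    rw [h2]
    exact Finset.single_le_sum (f := fun u : s => ‖⟪(u : L2 n), f⟫_ℂ‖)
      (fun _ _ => norm_nonneg _) (Finset.mem_univ u)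

end

/-! ### Conservation of the `L²` norm -/

theorem lipschitzWith_mulOp : LipschitzWith 1 (mulOp : (Space n →ᵇ ℝ) → L2 n →L[ℂ] L2 n) := by
  refine LipschitzWith.of_dist_le_mul fun W Z => ?_
  rw [dist_eq_norm, dist_eq_norm, NNReal.coe_one, one_mul]
  refine ContinuousLinearMap.opNorm_le_bound _ (norm_nonneg _) fun f => ?_
  rw [sub_apply, ← mulOp_sub]
  exact norm_mulOp_apply_le _ _

theorem continuousOn_mulOp {W : ℝ → Space n →ᵇ ℝ} {ψ : ℝ → L2 n} {s : Set ℝ}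
    (hW : ContinuousOn W s) (hψ : ContinuousOn ψ s) :
    ContinuousOn (fun t => mulOp (W t) (ψ t)) s :=
  (lipschitzWith_mulOp.continuous.comp_continuousOn hW).clm_apply hψ

/-- A weak derivative which is continuous is a strong derivative. -/
theorem hasDerivWithinAt_of_weak {g G : ℝ → L2 n} (hG : ContinuousOn G (Ici 0))
    (h : ∀ φ : 𝓢(Space n, ℂ), ∀ t : ℝ, 0 ≤ t →
      HasDerivWithinAt (fun s => ⟪toL2 φ, g s⟫_ℂ) ⟪toL2 φ, G t⟫_ℂ (Ici 0) t)
    {t : ℝ} (ht : 0 ≤ t) : HasDerivWithinAt g (G t) (Ici 0) t := by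
  rw [hasDerivWithinAt_iff_isLittleO, Asymptotics.isLittleO_iff]
  intro ε hε
  obtain ⟨δ, hδ, hball⟩ := Metric.continuousWithinAt_iff.1 (hG t ht) ε hε
  filter_upwards [inter_mem_nhdsWithin (Ici 0) (Metric.ball_mem_nhds t hδ)] with s hs
  refine norm_le_of_forall_inner_toL2 (by positivity) fun φ => ?_
  have hconv : Convex ℝ (Ici (0 : ℝ) ∩ Metric.ball t δ) := (convex_Ici 0).inter (convex_ball t δ)
  -- Subtracting the linear part with slope ⟨φ, G(t)⟩ lets the mean value inequality bound the
  -- remainder by ε|s - t|‖φ‖ on a neighbourhood independent of φ.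
  have hd : ∀ τ ∈ Ici (0 : ℝ) ∩ Metric.ball t δ,
      HasDerivWithinAt (fun τ : ℝ => ⟪toL2 φ, g τ⟫_ℂ - (τ : ℂ) * ⟪toL2 φ, G t⟫_ℂ)
        (⟪toL2 φ, G τ⟫_ℂ - 1 * ⟪toL2 φ, G t⟫_ℂ) (Ici 0 ∩ Metric.ball t δ) τ := fun τ hτ =>
    ((h φ τ hτ.1).mono inter_subset_left).sub
      ((Complex.ofRealCLM.hasDerivAt (x := τ)).hasDerivWithinAt.mul_const _)
  have hbound : ∀ τ ∈ Ici (0 : ℝ) ∩ Metric.ball t δ,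
      ‖⟪toL2 φ, G τ⟫_ℂ - 1 * ⟪toL2 φ, G t⟫_ℂ‖ ≤ ‖toL2 φ‖ * ε := fun τ hτ => by
    rw [one_mul, ← inner_sub_right]
    refine (norm_inner_le_norm _ _).trans ?_
    gcongr
    rw [← dist_eq_norm]
    exact (hball hτ.1 hτ.2).le
  have hle := hconv.norm_image_sub_le_of_norm_hasDerivWithin_le hd hbound
    ⟨ht, Metric.mem_ball_self hδ⟩ hs
  have heq : ⟪toL2 φ, g s - g t - (s - t) • G t⟫_ℂ =
      ⟪toL2 φ, g s⟫_ℂ - (s : ℂ) * ⟪toL2 φ, G t⟫_ℂ -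
        (⟪toL2 φ, g t⟫_ℂ - (t : ℂ) * ⟪toL2 φ, G t⟫_ℂ) := by
    have h1 : (s - t) • G t = ((s - t : ℝ) : ℂ) • G t := (Complex.coe_smul _ _).symm
    rw [inner_sub_right, inner_sub_right, h1, inner_smul_right]
    push_cast
    ring
  rw [heq]
  refine hle.trans (le_of_eq ?_)
  ring

/-- The Yosida approximations `l (-(1/2) Δ + l)⁻¹` of the identity. -/
theorem exists_yosida : ∃ (R : ℕ → 𝓢(Space n, ℂ) →ₗ[ℂ] 𝓢(Space n, ℂ)) (K : ℕ → L2 n →L[ℂ] L2 n),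
    (∀ (k : ℕ) φ, kinetic (R k φ) + ((k + 1 : ℝ) : ℂ) • R k φ = φ) ∧
    (∀ k φ, K k (toL2 φ) = toL2 (R k φ)) ∧ (∀ (k : ℕ) f, (k + 1 : ℝ) * ‖K k f‖ ≤ ‖f‖) ∧
    (∀ k f g, ⟪K k f, g⟫_ℂ = ⟪f, K k g⟫_ℂ) ∧
    ∀ f, Tendsto (fun k : ℕ => ((k + 1 : ℝ) : ℂ) • K k f) atTop (𝓝 f) := by
  choose R K hR hK hKn hKs using fun k : ℕ =>
    exists_resolvent (n := n) (l := (k + 1 : ℝ)) (by positivity)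
  refine ⟨R, K, hR, hK, hKn, hKs, fun f => ?_⟩
  -- With l = k + 1 and T the kinetic operator, φ - l(T + l)⁻¹φ = (T + l)⁻¹Tφ has norm at most
  -- ‖Tφ‖/l. Density and the uniform bound on l(T + l)⁻¹ extend the convergence to all of L².
  have hS : ∀ (k : ℕ) φ, (k + 1 : ℝ) * ‖((k + 1 : ℝ) : ℂ) • K k (toL2 φ) - toL2 φ‖ ≤
      ‖toL2 (kinetic φ)‖ := by
    intro k φ
    have h1 : kinetic (φ - ((k + 1 : ℝ) : ℂ) • R k φ) +
        ((k + 1 : ℝ) : ℂ) • (φ - ((k + 1 : ℝ) : ℂ) • R k φ) = kinetic φ := by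
      have h2 := congrArg (fun η => ((k + 1 : ℝ) : ℂ) • η) (hR k φ)
      simp only [smul_add] at h2
      rw [map_sub, map_smul, smul_sub]
      rw [← h2]
      abel
    have h3 := mul_norm_toL2_le_of_kinetic_add (k + 1 : ℝ) (φ - ((k + 1 : ℝ) : ℂ) • R k φ)
    rw [h1] at h3
    rwa [hK, norm_sub_rev, ← map_smul, ← map_sub]
  rw [Metric.tendsto_atTop]
  intro ε hε
  obtain ⟨φ, hφ⟩ := denseRange_toL2.exists_dist_lt f (show 0 < ε / 4 by positivity)
  obtain ⟨N, hN⟩ := exists_nat_gt (‖toL2 (kinetic φ)‖ / (ε / 4))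
  refine ⟨N, fun k hk => ?_⟩
  have hkpos : (0 : ℝ) < k + 1 := by positivity
  have h1 : ‖((k + 1 : ℝ) : ℂ) • K k (toL2 φ) - toL2 φ‖ < ε / 4 := by
    have h2 : ‖toL2 (kinetic φ)‖ < (k + 1) * (ε / 4) := by
      rw [div_lt_iff₀ (by positivity)] at hN
      refine hN.trans ?_
      have : (N : ℝ) ≤ k := by exact_mod_cast hk
      nlinarith
    exact lt_of_mul_lt_mul_left ((hS k φ).trans_lt h2) hkpos.le
  have h3 : ‖((k + 1 : ℝ) : ℂ) • K k (f - toL2 φ)‖ < ε / 4 := by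
    rw [norm_smul, Complex.norm_real, Real.norm_of_nonneg hkpos.le]
    refine (hKn k _).trans_lt ?_
    rwa [← dist_eq_norm]
  rw [dist_eq_norm] at hφ ⊢
  have h4 : ((k + 1 : ℝ) : ℂ) • K k f - f = ((k + 1 : ℝ) : ℂ) • K k (f - toL2 φ) +
      (((k + 1 : ℝ) : ℂ) • K k (toL2 φ) - toL2 φ) - (f - toL2 φ) := by
    rw [map_sub, smul_sub]; abel
  rw [h4]
  calc _ ≤ _ + _ + _ := (norm_sub_le _ _).trans (add_le_add_left (norm_add_le _ _) _)
    _ < ε := by linarith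

/-- The regularization of a weak solution by a resolvent is strongly differentiable. -/
theorem IsWeakSol.hasDerivWithinAt_resolvent {W : ℝ → Space n →ᵇ ℝ} {ψ : ℝ → L2 n}
    (hsol : IsWeakSol W ψ) (hψ : ContinuousOn ψ (Ici 0))
    (hWψ : ContinuousOn (fun t => mulOp (W t) (ψ t)) (Ici 0)) {l : ℝ}
    {R : 𝓢(Space n, ℂ) →ₗ[ℂ] 𝓢(Space n, ℂ)} {K : L2 n →L[ℂ] L2 n}
    (hR : ∀ φ, kinetic (R φ) + (l : ℂ) • R φ = φ) (hK : ∀ φ, K (toL2 φ) = toL2 (R φ))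
    (hKs : ∀ f g, ⟪K f, g⟫_ℂ = ⟪f, K g⟫_ℂ) {t : ℝ} (ht : 0 ≤ t) :
    HasDerivWithinAt (fun s => K (ψ s))
      ((-Complex.I) • (ψ t - (l : ℂ) • K (ψ t) + K (mulOp (W t) (ψ t)))) (Ici 0) t := by
  have hGc : ContinuousOn
      (fun t => (-Complex.I) • (ψ t - (l : ℂ) • K (ψ t) + K (mulOp (W t) (ψ t)))) (Ici 0) := by
    have h1 : ContinuousOn (fun t => K (ψ t)) (Ici 0) := K.continuous.comp_continuousOn hψ
    have h2 : ContinuousOn (fun t => K (mulOp (W t) (ψ t))) (Ici 0) :=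
      K.continuous.comp_continuousOn hWψ
    fun_prop
  refine hasDerivWithinAt_of_weak hGc (fun φ t ht => ?_) ht
  have h1 := hsol (R φ) t ht
  have h2 : ∀ s, ⟪toL2 (R φ), ψ s⟫_ℂ = ⟪toL2 φ, K (ψ s)⟫_ℂ := fun s => by rw [← hK, hKs]
  simp only [h2] at h1
  -- T(T + l)⁻¹ = 1 - l(T + l)⁻¹ is bounded, so the weak derivative of K ψ is a continuous L²-valued
  -- function.
  have h3 : toL2 (kinetic (R φ)) = toL2 φ - (l : ℂ) • toL2 (R φ) := by
    rw [eq_sub_iff_add_eq, ← map_smul, ← map_add, hR]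
  have h4 : ⟪toL2 φ, (-Complex.I) • (ψ t - (l : ℂ) • K (ψ t) + K (mulOp (W t) (ψ t)))⟫_ℂ =
      -Complex.I * ⟪toL2 (kinetic (R φ)) + mulOp (W t) (toL2 (R φ)), ψ t⟫_ℂ := by
    rw [h3, inner_smul_right, inner_add_right, inner_sub_right, inner_smul_right, inner_add_left,
      inner_sub_left, inner_smul_left, inner_mulOp_left, ← hK, hKs, hKs, Complex.conj_ofReal]
  rw [h4]
  exact h1

/-- The kinetic contributions cancel because K is symmetric. What is left involves only the
potential and vanishes as the regularization is removed. -/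
theorem IsWeakSol.hasDerivWithinAt_inner_resolvent {W : ℝ → Space n →ᵇ ℝ} {ψ : ℝ → L2 n}
    (hsol : IsWeakSol W ψ) (hψ : ContinuousOn ψ (Ici 0))
    (hWψ : ContinuousOn (fun t => mulOp (W t) (ψ t)) (Ici 0)) {l : ℝ}
    {R : 𝓢(Space n, ℂ) →ₗ[ℂ] 𝓢(Space n, ℂ)} {K : L2 n →L[ℂ] L2 n}
    (hR : ∀ φ, kinetic (R φ) + (l : ℂ) • R φ = φ) (hK : ∀ φ, K (toL2 φ) = toL2 (R φ))
    (hKs : ∀ f g, ⟪K f, g⟫_ℂ = ⟪f, K g⟫_ℂ) {t : ℝ} (ht : 0 ≤ t) :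
    HasDerivWithinAt (fun s => ⟪K (ψ s), K (ψ s)⟫_ℂ)
      (-Complex.I * ⟪K (ψ t), K (mulOp (W t) (ψ t))⟫_ℂ +
        Complex.I * ⟪K (mulOp (W t) (ψ t)), K (ψ t)⟫_ℂ) (Ici 0) t := by
  have h1 := hsol.hasDerivWithinAt_resolvent hψ hWψ hR hK hKs ht
  have h2 := h1.inner ℂ h1
  have h3 : ∀ f g : L2 n, ⟪K f, (-Complex.I) • (f - (l : ℂ) • K f + K g)⟫_ℂ +
      ⟪(-Complex.I) • (f - (l : ℂ) • K f + K g), K f⟫_ℂ =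
      -Complex.I * ⟪K f, K g⟫_ℂ + Complex.I * ⟪K g, K f⟫_ℂ := fun f g => by
    rw [inner_smul_right, inner_smul_left, inner_add_right, inner_sub_right, inner_smul_right,
      inner_add_left, inner_sub_left, inner_smul_left, Complex.conj_ofReal, hKs f f, map_neg,
      Complex.conj_I]
    ring
  rw [h3] at h2
  exact h2

/-- Weak solutions have constant `L²` norm. -/
theorem IsWeakSol.norm_eq {W : ℝ → Space n →ᵇ ℝ} {ψ : ℝ → L2 n} (hsol : IsWeakSol W ψ)
    (hψ : ContinuousOn ψ (Ici 0)) (hW : ContinuousOn W (Ici 0)) {T : ℝ} (hT : 0 ≤ T) :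
    ‖ψ T‖ = ‖ψ 0‖ := by
  obtain ⟨R, K, hR, hK, hKn, hKs, hKt⟩ := exists_yosida (n := n)
  have hWψ : ContinuousOn (fun t => mulOp (W t) (ψ t)) (Ici 0) :=
    continuousOn_mulOp hW hψ
  obtain ⟨J, hJ⟩ : ∃ J : ℕ → L2 n →L[ℂ] L2 n, ∀ k f, J k f = ((k + 1 : ℝ) : ℂ) • K k f :=
    ⟨fun k => ((k + 1 : ℝ) : ℂ) • K k, fun k f => rfl⟩
  have hJn : ∀ k f, ‖J k f‖ ≤ ‖f‖ := fun k f => by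
    rw [hJ, norm_smul, Complex.norm_real, Real.norm_of_nonneg (by positivity)]
    exact hKn k f
  have hJt : ∀ f, Tendsto (fun k => J k f) atTop (𝓝 f) := fun f => by
    simpa only [hJ] using hKt f
  have hJinner : ∀ k f g, ⟪J k f, J k g⟫_ℂ = ((k + 1 : ℝ) : ℂ) ^ 2 * ⟪K k f, K k g⟫_ℂ := by
    intro k f g
    rw [hJ, hJ, inner_smul_left, inner_smul_right, Complex.conj_ofReal]
    ring
  obtain ⟨D, hD⟩ : ∃ D : ℕ → ℝ → ℂ, ∀ k t, D k t =
      -Complex.I * ⟪J k (ψ t), J k (mulOp (W t) (ψ t))⟫_ℂ +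
        Complex.I * ⟪J k (mulOp (W t) (ψ t)), J k (ψ t)⟫_ℂ := ⟨_, fun _ _ => rfl⟩
  have hDder : ∀ k t, 0 ≤ t → HasDerivWithinAt (fun s => ⟪J k (ψ s), J k (ψ s)⟫_ℂ)
      (D k t) (Ici 0) t := by
    intro k t ht
    have h1 := (hsol.hasDerivWithinAt_inner_resolvent hψ hWψ (hR k) (hK k) (hKs k) ht).const_mul
      (((k + 1 : ℝ) : ℂ) ^ 2)
    simp only [hD, hJinner]
    rw [mul_add, mul_left_comm _ (-Complex.I), mul_left_comm _ Complex.I] at h1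
    exact h1
  have hDc : ∀ k, ContinuousOn (D k) (Ici 0) := by
    intro k
    have h1 : ContinuousOn (fun t => J k (ψ t)) (Ici 0) := (J k).continuous.comp_continuousOn hψ
    have h2 : ContinuousOn (fun t => J k (mulOp (W t) (ψ t))) (Ici 0) :=
      (J k).continuous.comp_continuousOn hWψ
    refine ContinuousOn.congr (f := fun t => -Complex.I * ⟪J k (ψ t), J k (mulOp (W t) (ψ t))⟫_ℂ +
        Complex.I * ⟪J k (mulOp (W t) (ψ t)), J k (ψ t)⟫_ℂ) ?_ fun t _ => hD k t
    exact (continuousOn_const.mul (h1.inner h2)).add (continuousOn_const.mul (h2.inner h1))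
  -- As J k tends to the identity the two terms tend to -i⟨ψ, Wψ⟩ and i⟨Wψ, ψ⟩, which cancel because
  -- W is real.
  have hDlim : ∀ t, Tendsto (fun k => D k t) atTop (𝓝 0) := by
    intro t
    have h1 := (((hJt (ψ t)).inner (hJt (mulOp (W t) (ψ t))) (𝕜 := ℂ)).const_mul (-Complex.I)).add
      (((hJt (mulOp (W t) (ψ t))).inner (hJt (ψ t)) (𝕜 := ℂ)).const_mul Complex.I)
    rw [inner_mulOp_left, neg_mul, neg_add_cancel] at h1
    exact h1.congr fun k => by rw [hD, neg_mul]
  have hDbound : ∀ k t, ‖D k t‖ ≤ 2 * (‖ψ t‖ * ‖mulOp (W t) (ψ t)‖) := by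
    intro k t
    rw [hD, two_mul]
    refine (norm_add_le _ _).trans (add_le_add ?_ ?_)
    · rw [norm_mul, norm_neg, Complex.norm_I, one_mul]
      refine (norm_inner_le_norm _ _).trans ?_
      gcongr <;> exact hJn _ _
    · rw [norm_mul, Complex.norm_I, one_mul, mul_comm]
      refine (norm_inner_le_norm _ _).trans ?_
      gcongr <;> exact hJn _ _
  have hsub : uIcc 0 T ⊆ Ici 0 := by
    rw [uIcc_of_le hT]; exact Icc_subset_Ici_self
  have hFTC : ∀ k, ∫ t in (0 : ℝ)..T, D k t =
      ⟪J k (ψ T), J k (ψ T)⟫_ℂ - ⟪J k (ψ 0), J k (ψ 0)⟫_ℂ := by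
    intro k
    refine intervalIntegral.integral_eq_sub_of_hasDeriv_right
      (f := fun s => ⟪J k (ψ s), J k (ψ s)⟫_ℂ)
      (fun t ht => ((hDder k t (hsub ht)).continuousWithinAt).mono hsub)
      (fun t ht => ?_) ((hDc k).mono hsub).intervalIntegrable
    rw [min_eq_left hT] at ht
    exact (hDder k t ht.1.le).mono fun s hs => ht.1.le.trans (le_of_lt hs)
  have hbc : ContinuousOn (fun t => 2 * (‖ψ t‖ * ‖mulOp (W t) (ψ t)‖)) (uIcc 0 T) :=
    (continuousOn_const.mul (hψ.norm.mul hWψ.norm)).mono hsub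
  have hlim1 : Tendsto (fun k => ∫ t in (0 : ℝ)..T, D k t) atTop
      (𝓝 (∫ _ in (0 : ℝ)..T, (0 : ℂ))) := by
    refine intervalIntegral.tendsto_integral_filter_of_dominated_convergence
      (fun t => 2 * (‖ψ t‖ * ‖mulOp (W t) (ψ t)‖)) (Eventually.of_forall fun k => ?_)
      (Eventually.of_forall fun k => ae_of_all _ fun t _ => hDbound k t)
      hbc.intervalIntegrable (ae_of_all _ fun t _ => hDlim t)
    exact ((hDc k).mono hsub).intervalIntegrable.def'.aestronglyMeasurable
  have hlim2 : ∀ f : L2 n, Tendsto (fun k : ℕ => ⟪J k f, J k f⟫_ℂ) atTop (𝓝 ⟪f, f⟫_ℂ) :=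
    fun f => (hJt f).inner (hJt f)
  have h0 := tendsto_nhds_unique (hlim1.congr hFTC) ((hlim2 (ψ T)).sub (hlim2 (ψ 0)))
  rw [intervalIntegral.integral_zero, inner_self_eq_norm_sq_to_K, inner_self_eq_norm_sq_to_K] at h0
  have h1 : ‖ψ T‖ ^ 2 = ‖ψ 0‖ ^ 2 := by exact_mod_cast (sub_eq_zero.1 h0.symm)
  exact (pow_left_inj₀ (norm_nonneg _) (norm_nonneg _) two_ne_zero).1 h1

section

/-! ### Galilei transforms -/

open scoped ENNReal

/-- A product rule in which ψ is only continuous and differentiable against the fixed vector Φ t.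
The increment of Φ is strongly differentiable, so continuity of ψ suffices for the other term. -/
theorem hasDerivWithinAt_inner_of_weak {Φ ψ : ℝ → L2 n} {Φ' : L2 n} {d : ℂ} {S : Set ℝ} {t : ℝ}
    (hΦ : HasDerivWithinAt Φ Φ' S t) (hψ : ContinuousWithinAt ψ S t)
    (h : HasDerivWithinAt (fun s => ⟪Φ t, ψ s⟫_ℂ) d S t) :
    HasDerivWithinAt (fun s => ⟪Φ s, ψ s⟫_ℂ) (d + ⟪Φ', ψ t⟫_ℂ) S t := by
  have hk : HasDerivWithinAt (fun s => ⟪Φ s - Φ t, ψ s⟫_ℂ) ⟪Φ', ψ t⟫_ℂ S t := by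
    rw [hasDerivWithinAt_iff_tendsto_slope] at hΦ ⊢
    have h1 : Tendsto ψ (𝓝[S \ {t}] t) (𝓝 (ψ t)) := hψ.mono_left (nhdsWithin_mono _ sdiff_subset)
    refine (hΦ.inner h1 (𝕜 := ℂ)).congr fun s => ?_
    have h2 : slope Φ t s = (((s - t)⁻¹ : ℝ) : ℂ) • (Φ s - Φ t) := by
      rw [slope, vsub_eq_sub]; exact (Complex.coe_smul _ _).symm
    rw [h2, inner_smul_left, Complex.conj_ofReal, slope, vsub_eq_sub, sub_self, inner_zero_left,
      sub_zero, Complex.real_smul]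
  refine (h.add hk).congr_deriv rfl |>.congr (fun s _ => ?_) ?_
  · rw [Pi.add_apply, inner_sub_left, add_sub_cancel]
  · rw [Pi.add_apply, inner_sub_left, add_sub_cancel]

theorem lineDeriv_translateS (y v : Space n) (f : 𝓢(Space n, ℂ)) :
    ∂_{v} (translateS y f) = translateS y (∂_{v} f) := by
  ext x
  rw [translateS_apply, SchwartzMap.lineDerivOp_apply_eq_fderiv,
    SchwartzMap.lineDerivOp_apply_eq_fderiv]
  have : (translateS y f : Space n → ℂ) = fun x => f (x + y) := by funext x; simp
  rw [this, fderiv_comp_add_right]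

theorem kinetic_translateS (y : Space n) (f : 𝓢(Space n, ℂ)) :
    kinetic (translateS y f) = translateS y (kinetic f) := by
  ext x
  simp only [kinetic_apply, translateS_apply,
    SchwartzMap.laplacian_eq_sum (EuclideanSpace.basisFun (Fin n) ℝ), lineDeriv_translateS,
    sum_apply]

/-- The Taylor remainder is the average of the increments of ∂_y f, to which the first-order bound
applies. Being quadratic in y, the bound yields differentiability of translations. -/
theorem norm_translateS_sub_sub_le (y : Space n) (f : 𝓢(Space n, ℂ)) :
    ‖toL2 (translateS y f - f - ∂_{y} f)‖ ≤ ‖toL2 (∂_{y} (∂_{y} f))‖ := by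
  refine enorm_le_of_lintegral_sq_le ?_
  refine lintegral_enorm_sq_average_le
    (G := fun s x => ∂_{y} f (x + s • y) - ∂_{y} f x) (by unfold Function.uncurry; fun_prop)
    (fun x => ?_) fun s hs => ?_
  · rw [intervalIntegral.integral_sub (Continuous.intervalIntegrable (by fun_prop) _ _)
      (Continuous.intervalIntegrable (by fun_prop) _ _), ← schwartz_translate_sub]
    simp
  · have h1 := enorm_sq_toL2 (translateS (s • y) (∂_{y} f) - ∂_{y} f)
    simp only [sub_apply, translateS_apply] at h1
    rw [← h1]
    gcongr
    rw [enorm_le_iff_norm_le]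
    refine (norm_toL2_translateS_sub_le (s • y) (∂_{y} f)).trans ?_
    rw [LineDeriv.lineDerivOp_left_smul]
    have h2 : s • ∂_{y} (∂_{y} f) = (s : ℂ) • ∂_{y} (∂_{y} f) := by ext x; simp
    rw [h2, map_smul, norm_smul, Complex.norm_real, Real.norm_of_nonneg hs.1]
    exact mul_le_of_le_one_left (norm_nonneg _) hs.2

/-- Translations of a Schwartz function are differentiable in `L²`. -/
theorem hasDerivAt_toL2_translateS (w : Space n) (f : 𝓢(Space n, ℂ)) (t : ℝ) :
    HasDerivAt (fun s : ℝ => toL2 (translateS (s • w) f)) (toL2 (translateS (t • w) (∂_{w} f))) t := by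
  rw [hasDerivAt_iff_isLittleO, Asymptotics.isLittleO_iff]
  intro ε hε
  set M := ‖toL2 (∂_{w} (∂_{w} f))‖
  have hM : 0 ≤ M := norm_nonneg _
  filter_upwards [Metric.ball_mem_nhds t (show 0 < ε / (M + 1) by positivity)] with s hs
  rw [Metric.mem_ball, Real.dist_eq, lt_div_iff₀ (by positivity)] at hs
  have h1 : toL2 (translateS (s • w) f) - toL2 (translateS (t • w) f) -
      (s - t) • toL2 (translateS (t • w) (∂_{w} f)) =
      toL2 (translateS (t • w) (translateS ((s - t) • w) f - f - ∂_{(s - t) • w} f)) := by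
    have h2 : (s - t) • toL2 (translateS (t • w) (∂_{w} f)) =
        ((s - t : ℝ) : ℂ) • toL2 (translateS (t • w) (∂_{w} f)) := (Complex.coe_smul _ _).symm
    rw [h2, ← map_smul, ← map_sub, ← map_sub]
    congr 1
    ext x
    simp only [sub_apply, smul_apply, translateS_apply, LineDeriv.lineDerivOp_left_smul]
    rw [Complex.real_smul, smul_eq_mul, sub_smul,
      show x + t • w + (s • w - t • w) = x + s • w by abel]
  rw [h1, norm_toL2_translateS]
  refine (norm_translateS_sub_sub_le _ _).trans ?_
  have h3 : ∂_{(s - t) • w} (∂_{(s - t) • w} f) = (((s - t) ^ 2 : ℝ) : ℂ) • ∂_{w} (∂_{w} f) := by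
    ext x
    simp only [LineDeriv.lineDerivOp_left_smul, LineDeriv.lineDerivOp_smul, smul_apply, Complex.real_smul, smul_eq_mul]
    push_cast; ring
  rw [h3, map_smul, norm_smul, Complex.norm_real, norm_pow, Real.norm_eq_abs]
  nlinarith [abs_nonneg (s - t)]

theorem hasTemperateGrowth_cexp_I_mul : (fun t : ℝ => Complex.exp (Complex.I * t)).HasTemperateGrowth := by
  have hd : ∀ k : ℕ, iteratedDeriv k (fun t : ℝ => Complex.exp (Complex.I * t)) =
      fun t : ℝ => Complex.I ^ k * Complex.exp (Complex.I * t) := by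
    intro k
    induction k with
    | zero => simp
    | succ k ih =>
      rw [iteratedDeriv_succ, ih]
      funext t
      have h1 : HasDerivAt (fun t : ℝ => Complex.I * (t : ℂ)) (Complex.I * 1) t :=
        (Complex.ofRealCLM.hasDerivAt (x := t)).const_mul _
      rw [(h1.cexp.const_mul (Complex.I ^ k)).deriv]
      ring
  refine ⟨(contDiff_const.mul Complex.ofRealCLM.contDiff).cexp, fun k => ⟨0, 1, fun x => ?_⟩⟩
  rw [norm_iteratedFDeriv_eq_norm_iteratedDeriv, hd, pow_zero, mul_one, norm_mul, norm_pow,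
    Complex.norm_I, one_pow, one_mul, mul_comm, Complex.norm_exp_ofReal_mul_I]

/-- The plane wave `x ↦ e^{i x·v}`. -/
def planeWave (v x : Space n) : ℂ := Complex.exp (Complex.I * ((⟪x, v⟫_ℝ : ℝ) : ℂ))

theorem hasTemperateGrowth_planeWave (v : Space n) : (planeWave v).HasTemperateGrowth :=
  hasTemperateGrowth_cexp_I_mul.comp (f := fun x : Space n => ⟪x, v⟫_ℝ) (by fun_prop)

theorem hasFDerivAt_planeWave (v x : Space n) :
    HasFDerivAt (planeWave v) ((planeWave v x * Complex.I) • (Complex.ofRealCLM ∘L innerSL ℝ v)) x := by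
  have h1 : HasFDerivAt (fun x : Space n => Complex.I * ((⟪x, v⟫_ℝ : ℝ) : ℂ))
      (Complex.I • (Complex.ofRealCLM ∘L innerSL ℝ v)) x := by
    have := ((Complex.ofRealCLM ∘L innerSL ℝ v).hasFDerivAt (x := x)).const_mul Complex.I
    simpa [real_inner_comm] using this
  have := h1.cexp
  rw [smul_smul] at this
  exact this

/-- Multiplication of Schwartz functions by a plane wave. -/
def modulate (v : Space n) : 𝓢(Space n, ℂ) →ₗ[ℂ] 𝓢(Space n, ℂ) :=
  (SchwartzMap.smulLeftCLM ℂ (planeWave v)).toLinearMap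

@[simp] theorem modulate_apply (v : Space n) (f : 𝓢(Space n, ℂ)) (x : Space n) :
    modulate v f x = planeWave v x * f x := by
  simp [modulate, SchwartzMap.smulLeftCLM_apply_apply (hasTemperateGrowth_planeWave v)]

theorem lineDeriv_modulate (v w : Space n) (f : 𝓢(Space n, ℂ)) :
    ∂_{w} (modulate v f) =
      (Complex.I * ((⟪v, w⟫_ℝ : ℝ) : ℂ)) • modulate v f + modulate v (∂_{w} f) := by
  ext x
  have h1 : (modulate v f : Space n → ℂ) = fun x => planeWave v x * f x := by funext x; simp
  rw [SchwartzMap.lineDerivOp_apply_eq_fderiv, h1,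
    ((hasFDerivAt_planeWave v x).fun_mul (f.hasFDerivAt x)).fderiv]
  simp [SchwartzMap.lineDerivOp_apply_eq_fderiv]
  ring

theorem lineDeriv_eq_sum (y : Space n) (f : 𝓢(Space n, ℂ)) :
    ∂_{y} f = ∑ i, (y i : ℂ) • ∂_{EuclideanSpace.basisFun (Fin n) ℝ i} f := by
  ext x
  simp only [SchwartzMap.lineDerivOp_apply_eq_fderiv, sum_apply, smul_apply]
  conv_lhs => rw [← (EuclideanSpace.basisFun (Fin n) ℝ).sum_repr y]
  simp

/-- A plane wave shifts momentum by v. The drift is written as ∂_v of the modulated function so that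
it matches the time derivative of the translation in the Galilei transform. -/
theorem kinetic_modulate (v : Space n) (f : 𝓢(Space n, ℂ)) :
    kinetic (modulate v f) = modulate v (kinetic f) - ((‖v‖ ^ 2 / 2 : ℝ) : ℂ) • modulate v f -
      Complex.I • ∂_{v} (modulate v f) := by
  have h1 : Δ (modulate v f) = modulate v (Δ f) - ((‖v‖ ^ 2 : ℝ) : ℂ) • modulate v f +
      (2 * Complex.I) • modulate v (∂_{v} f) := by
    rw [SchwartzMap.laplacian_eq_sum (EuclideanSpace.basisFun (Fin n) ℝ),
      SchwartzMap.laplacian_eq_sum (EuclideanSpace.basisFun (Fin n) ℝ), lineDeriv_eq_sum v f,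
      EuclideanSpace.norm_sq_eq]
    ext x
    simp only [lineDeriv_modulate, LineDeriv.lineDerivOp_add, LineDeriv.lineDerivOp_smul, add_apply, sub_apply, smul_apply,
      sum_apply, modulate_apply, smul_eq_mul, Finset.mul_sum]
    push_cast
    rw [Finset.sum_mul, ← Finset.sum_sub_distrib, ← Finset.sum_add_distrib]
    refine Finset.sum_congr rfl fun i _ => ?_
    have h2 : ⟪v, EuclideanSpace.basisFun (Fin n) ℝ i⟫_ℝ = v i := by
      simp [EuclideanSpace.inner_single_right]
    rw [h2, Real.norm_eq_abs, ← Complex.ofReal_pow, sq_abs]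
    push_cast
    ring_nf
    rw [Complex.I_sq]
    ring
  rw [kinetic_eq, kinetic_eq, h1, lineDeriv_modulate, real_inner_self_eq_norm_sq]
  ext x
  simp only [add_apply, sub_apply, smul_apply, smul_eq_mul, map_smul, modulate_apply]
  push_cast
  ring_nf
  rw [Complex.I_sq]
  ring

end

/-! ### Galilei transforms on L² and covariance of the equation. -/

theorem coeFn_galilei (v : Space n) (t : ℝ) (f : L2 n) :
    (galilei v t f : Space n → ℂ) =ᵐ[volume] galileiFun v t f :=
  (galileiFun_memLp v t f).coeFn_toLp

theorem norm_cexp_neg_I_mul (r : ℝ) : ‖Complex.exp (-Complex.I * (r : ℂ))‖ = 1 := by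
  simp [Complex.norm_exp]

theorem norm_galilei (v : Space n) (t : ℝ) (f : L2 n) : ‖galilei v t f‖ = ‖f‖ := by
  rw [← (translate (t • v)).norm_map f]
  have h : ∀ᵐ x, ‖(galilei v t f : Space n → ℂ) x‖ = ‖(translate (t • v) f : Space n → ℂ) x‖ := by
    filter_upwards [coeFn_galilei v t f, coeFn_translate (t • v) f] with x h1 h2
    rw [h1, h2, galileiFun, norm_mul, norm_mul, norm_cexp_neg_I_mul, norm_cexp_neg_I_mul]
    simp
  exact le_antisymm (Lp.norm_le_norm_of_ae_le (h.mono fun x hx => hx.le))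
    (Lp.norm_le_norm_of_ae_le (h.mono fun x hx => hx.ge))

theorem conj_cexp_neg_I_mul (r : ℝ) :
    conj (Complex.exp (-Complex.I * (r : ℂ))) = Complex.exp (Complex.I * (r : ℂ)) := by
  rw [← Complex.exp_conj]; simp

/-- Change variables by t v: the shift adds t|v|² to the phase, which turns -|v|²t/2 into the phase
required for velocity -v. -/
theorem inner_galilei (v : Space n) (t : ℝ) (f g : L2 n) :
    ⟪g, galilei v t f⟫_ℂ = ⟪galilei (-v) t g, f⟫_ℂ := by
  have h1 : ⟪galilei (-v) t g, f⟫_ℂ = ∫ x, f x * conj (galileiFun (-v) t g x) := by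
    rw [inner_L2_eq_integral]
    refine integral_congr_ae ?_
    filter_upwards [coeFn_galilei (-v) t g] with x hx
    rw [hx]
  rw [h1, ← integral_add_right_eq_self _ (t • v), inner_L2_eq_integral]
  refine integral_congr_ae ?_
  filter_upwards [coeFn_galilei v t f] with x hx
  rw [hx, galileiFun, galileiFun, map_mul, map_mul, conj_cexp_neg_I_mul, conj_cexp_neg_I_mul,
    smul_neg, add_neg_cancel_right]
  have h2 : Complex.exp (-Complex.I * ((‖v‖ ^ 2 / 2 * t : ℝ) : ℂ)) *
      Complex.exp (-Complex.I * ((⟪x, v⟫_ℝ : ℝ) : ℂ)) =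
      Complex.exp (Complex.I * ((‖-v‖ ^ 2 / 2 * t : ℝ) : ℂ)) *
        Complex.exp (Complex.I * ((⟪x + t • v, -v⟫_ℝ : ℝ) : ℂ)) := by
    rw [← Complex.exp_add, ← Complex.exp_add]
    congr 1
    rw [norm_neg, inner_neg_right, inner_add_left, inner_smul_left, real_inner_self_eq_norm_sq]
    simp only [conj_trivial]
    push_cast
    ring
  rw [h2]
  ring

/-- The Galilei transform `𝔤_{-v}(t)` on the Schwartz space. -/
def galileiS (v : Space n) (t : ℝ) (φ : 𝓢(Space n, ℂ)) : 𝓢(Space n, ℂ) :=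
  Complex.exp (Complex.I * ((‖v‖ ^ 2 / 2 * t : ℝ) : ℂ)) • translateS (t • -v) (modulate v φ)

theorem galilei_toL2 (v : Space n) (t : ℝ) (φ : 𝓢(Space n, ℂ)) :
    galilei (-v) t (toL2 φ) = toL2 (galileiS v t φ) := by
  apply Lp.ext
  filter_upwards [coeFn_galilei (-v) t (toL2 φ), coeFn_toL2 (galileiS v t φ),
    (measurePreserving_add_right volume (t • -v)).quasiMeasurePreserving.ae_eq (coeFn_toL2 φ)]
    with x h1 h2 h3
  have h4 : toL2 φ (x + t • -v) = φ (x + t • -v) := h3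
  rw [h1, h2, galileiFun, h4, galileiS, smul_apply, translateS_apply, modulate_apply, planeWave,
    smul_eq_mul, ← mul_assoc, ← Complex.exp_add, ← Complex.exp_add]
  congr 2
  rw [norm_neg, inner_neg_right, inner_add_left, inner_smul_left, inner_neg_left,
    real_inner_self_eq_norm_sq]
  simp only [conj_trivial]
  push_cast
  ring

theorem galilei_mulOp (v : Space n) (t : ℝ) (W : Space n →ᵇ ℝ) (g : L2 n) :
    galilei (-v) t (mulOp (translateBCF W (t • -v)) g) = mulOp W (galilei (-v) t g) := by
  apply Lp.ext
  filter_upwards [coeFn_galilei (-v) t (mulOp (translateBCF W (t • -v)) g),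
    coeFn_mulOp W (galilei (-v) t g), coeFn_galilei (-v) t g,
    (measurePreserving_add_right volume (t • -v)).quasiMeasurePreserving.ae_eq
      (coeFn_mulOp (translateBCF W (t • -v)) g)] with x h1 h2 h3 h4
  have h5 : mulOp (translateBCF W (t • -v)) g (x + t • -v) =
      (translateBCF W (t • -v) (x + t • -v) : ℂ) * g (x + t • -v) := h4
  rw [h1, h2, h3, galileiFun, galileiFun, h5, translateBCF_apply, add_sub_cancel_right]
  ring

/-- The derivative is the commutator with the kinetic operator: the drift of the translation and the
scalar phase cancel the extra terms of `kinetic_modulate`. Hence the transform preserves the free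
equation. -/
theorem hasDerivAt_galileiS (v : Space n) (φ : 𝓢(Space n, ℂ)) (t : ℝ) :
    HasDerivAt (fun s => toL2 (galileiS v s φ))
      (Complex.I • (toL2 (galileiS v t (kinetic φ)) - toL2 (kinetic (galileiS v t φ)))) t := by
  have hc : HasDerivAt (fun s : ℝ => Complex.exp (Complex.I * ((‖v‖ ^ 2 / 2 * s : ℝ) : ℂ)))
      (Complex.exp (Complex.I * ((‖v‖ ^ 2 / 2 * t : ℝ) : ℂ)) *
        (Complex.I * ((‖v‖ ^ 2 / 2 * 1 : ℝ) : ℂ))) t :=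
    (((((hasDerivAt_id t).const_mul (‖v‖ ^ 2 / 2)).ofReal_comp).const_mul Complex.I)).cexp
  have h1 := hc.smul (hasDerivAt_toL2_translateS (-v) (modulate v φ) t)
  have h2 : (fun s => toL2 (galileiS v s φ)) = fun s : ℝ =>
      Complex.exp (Complex.I * ((‖v‖ ^ 2 / 2 * s : ℝ) : ℂ)) •
        toL2 (translateS (s • -v) (modulate v φ)) := by
    funext s; rw [galileiS, map_smul]
  rw [h2]
  refine h1.congr_deriv ?_
  rw [← map_smul, ← map_smul, ← map_add, ← map_sub, ← map_smul]
  congr 1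
  have h3 := kinetic_modulate v φ
  have h4 : modulate v (kinetic φ) = kinetic (modulate v φ) +
      ((‖v‖ ^ 2 / 2 : ℝ) : ℂ) • modulate v φ + Complex.I • ∂_{v} (modulate v φ) := by
    rw [h3]; abel
  ext x
  simp only [galileiS, map_smul, kinetic_translateS, h4, LineDeriv.lineDerivOp_left_neg,
    add_apply, sub_apply, smul_apply, translateS_apply, neg_apply, smul_eq_mul]
  push_cast
  ring_nf
  rw [Complex.I_sq]
  ring

/-- Galilei covariance of the Schrödinger equation. -/
theorem IsWeakSol.galilei {W : ℝ → Space n →ᵇ ℝ} {ψ : ℝ → L2 n} (hsol : IsWeakSol W ψ)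
    (hψ : ContinuousOn ψ (Ici 0)) (v : Space n) :
    IsWeakSol (fun t => translateBCF (W t) (t • -v)) (fun t => ChargeTransfer.galilei v t (ψ t)) := by
  intro φ t ht
  have h1 := hasDerivWithinAt_inner_of_weak (hasDerivAt_galileiS v φ t).hasDerivWithinAt (hψ t ht)
    (hsol (galileiS v t φ) t ht)
  have h2 : ∀ s, ⟪toL2 φ, ChargeTransfer.galilei v s (ψ s)⟫_ℂ = ⟪toL2 (galileiS v s φ), ψ s⟫_ℂ :=
    fun s => by rw [inner_galilei, galilei_toL2]
  simp only [h2]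
  refine h1.congr_deriv ?_
  rw [inner_add_left, inner_add_left, inner_galilei, inner_galilei, galilei_mulOp, galilei_toL2,
    galilei_toL2, inner_smul_left, inner_sub_left, Complex.conj_I]
  ring

/-! ### Decay of the bound state components -/

/-- The phase e^{iEt} removes the eigenvalue, so the derivative of e^{iEt}⟨u, χ⟩ has size at most C
B e^{-at}. Integrating from s to infinity, where the pairing vanishes, gives the factor 1/a. -/
theorem norm_inner_le_of_tendsto_zero {V : Space n →ᵇ ℝ} {E : ℝ} {u : L2 n}
    (hu : IsWeakEq V u ((E : ℂ) • u)) {W : ℝ → Space n →ᵇ ℝ} {χ : ℝ → L2 n}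
    (hsol : IsWeakSol W χ) {B M C a : ℝ} (ha : 0 < a) (hM : ∀ t, 0 ≤ t → ‖W t‖ ≤ M)
    (hB : ∀ t, 0 ≤ t → ‖χ t‖ ≤ B)
    (hC : ∀ t, 0 ≤ t → ‖mulOp (W t - V) u‖ ≤ C * Real.exp (-a * t))
    (hlim : Tendsto (fun t => ⟪u, χ t⟫_ℂ) atTop (𝓝 0)) {s : ℝ} (hs : 0 ≤ s) :
    ‖⟪u, χ s⟫_ℂ‖ ≤ C * B / a * Real.exp (-a * s) := by
  obtain ⟨f, hf, hTf⟩ := hu.exists_seq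
  have hB0 : 0 ≤ B := (norm_nonneg _).trans (hB 0 le_rfl)
  have hC0 : 0 ≤ C := by simpa using (norm_nonneg _).trans (hC 0 le_rfl)
  have hM0 : 0 ≤ M := (norm_nonneg _).trans (hM 0 le_rfl)
  obtain ⟨e, he⟩ : ∃ e : ℝ → ℂ, ∀ τ, e τ = Complex.exp (Complex.I * ((E * τ : ℝ) : ℂ)) :=
    ⟨_, fun _ => rfl⟩
  have hen : ∀ τ, ‖e τ‖ = 1 := fun τ => by rw [he, mul_comm, Complex.norm_exp_ofReal_mul_I]
  have hed : ∀ τ, HasDerivAt e (e τ * (Complex.I * (E : ℂ))) τ := fun τ => by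
    have h1 : HasDerivAt (fun τ : ℝ => Complex.exp (Complex.I * ((E * τ : ℝ) : ℂ)))
      (Complex.exp (Complex.I * ((E * τ : ℝ) : ℂ)) * (Complex.I * ((E * 1 : ℝ) : ℂ))) τ :=
      (((((hasDerivAt_id τ).const_mul E).ofReal_comp).const_mul Complex.I)).cexp
    rw [funext he]
    simpa using h1
  set ε : ℕ → ℝ := fun k => ‖toL2 (kinetic (f k)) - ((E : ℂ) • u - mulOp V u)‖ +
    (M + |E|) * ‖toL2 (f k) - u‖ with hε
  have hεlim : Tendsto ε atTop (𝓝 0) := by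
    have h1 := (tendsto_iff_norm_sub_tendsto_zero.1 hTf).add
      ((tendsto_iff_norm_sub_tendsto_zero.1 hf).const_mul (M + |E|))
    rwa [mul_zero, add_zero] at h1
  have hderiv : ∀ k τ, 0 ≤ τ → HasDerivWithinAt (fun τ => e τ * ⟪toL2 (f k), χ τ⟫_ℂ)
      (e τ * (-Complex.I * ⟪toL2 (kinetic (f k)) + mulOp (W τ) (toL2 (f k)) -
        (E : ℂ) • toL2 (f k), χ τ⟫_ℂ)) (Ici 0) τ := by
    intro k τ hτ
    refine ((hed τ).hasDerivWithinAt.mul (hsol (f k) τ hτ)).congr_deriv ?_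
    rw [inner_sub_left, inner_smul_left, Complex.conj_ofReal]
    ring
  have hbound : ∀ k τ, 0 ≤ τ → ‖e τ * (-Complex.I * ⟪toL2 (kinetic (f k)) +
      mulOp (W τ) (toL2 (f k)) - (E : ℂ) • toL2 (f k), χ τ⟫_ℂ)‖ ≤
      ε k * B + C * B * Real.exp (-a * τ) := by
    intro k τ hτ
    rw [norm_mul, hen, one_mul, norm_mul, norm_neg, Complex.norm_I, one_mul]
    -- Since (T + V - E)u = 0 for the kinetic operator T, applying T + W - E to f k leaves
    -- graph-norm errors and the single term (W - V)u.
    have h1 : toL2 (kinetic (f k)) + mulOp (W τ) (toL2 (f k)) - (E : ℂ) • toL2 (f k) =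
        (toL2 (kinetic (f k)) - ((E : ℂ) • u - mulOp V u)) + mulOp (W τ) (toL2 (f k) - u) -
          (E : ℂ) • (toL2 (f k) - u) + mulOp (W τ - V) u := by
      rw [map_sub, mulOp_sub, smul_sub]; abel
    have h2 : ‖mulOp (W τ) (toL2 (f k) - u)‖ ≤ M * ‖toL2 (f k) - u‖ :=
      (norm_mulOp_apply_le _ _).trans (by gcongr; exact hM τ hτ)
    have h3 : ‖(E : ℂ) • (toL2 (f k) - u)‖ = |E| * ‖toL2 (f k) - u‖ := by
      rw [norm_smul, Complex.norm_real, Real.norm_eq_abs]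
    have h4 : ‖toL2 (kinetic (f k)) + mulOp (W τ) (toL2 (f k)) - (E : ℂ) • toL2 (f k)‖ ≤
        ε k + C * Real.exp (-a * τ) := by
      rw [h1]
      refine (norm_add_le _ _).trans (add_le_add ?_ (hC τ hτ))
      refine (norm_sub_le _ _).trans ?_
      have := norm_add_le (toL2 (kinetic (f k)) - ((E : ℂ) • u - mulOp V u))
        (mulOp (W τ) (toL2 (f k) - u))
      simp only [hε]
      linarith
    calc _ ≤ _ := norm_inner_le_norm _ _
      _ ≤ (ε k + C * Real.exp (-a * τ)) * B := by
        exact mul_le_mul h4 (hB τ hτ) (norm_nonneg _) ((norm_nonneg _).trans h4)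
      _ = _ := by ring
  have hdiff : ∀ t, s ≤ t → ‖e t * ⟪u, χ t⟫_ℂ - e s * ⟪u, χ s⟫_ℂ‖ ≤
      C * B / a * Real.exp (-a * s) := by
    intro t hst
    -- The error ε k B (t - s) grows with t, so k tends to infinity at fixed t, before t does.
    have hk : ∀ k, ‖e t * ⟪toL2 (f k), χ t⟫_ℂ - e s * ⟪toL2 (f k), χ s⟫_ℂ‖ ≤
        ε k * B * (t - s) + C * B / a * (Real.exp (-a * s) - Real.exp (-a * t)) := by
      intro k
      refine image_norm_le_of_norm_deriv_right_le_deriv_boundary (a := s) (b := t)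
        (f := fun τ => e τ * ⟪toL2 (f k), χ τ⟫_ℂ - e s * ⟪toL2 (f k), χ s⟫_ℂ)
        (B := fun τ => ε k * B * (τ - s) + C * B / a * (Real.exp (-a * s) - Real.exp (-a * τ)))
        (B' := fun τ => ε k * B + C * B * Real.exp (-a * τ))
        (fun τ hτ => ?_) (fun τ hτ => ?_) (by simp) (fun τ => ?_)
        (fun τ hτ => hbound k τ (hs.trans hτ.1)) ⟨hst, le_rfl⟩
      · exact (((hderiv k τ (hs.trans hτ.1)).continuousWithinAt).sub
          continuousWithinAt_const).mono fun x hx => hs.trans hx.1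
      · exact ((hderiv k τ (hs.trans hτ.1)).sub_const _).mono
          (Ici_subset_Ici.2 (hs.trans hτ.1))
      · have h1 : HasDerivAt (fun τ => ε k * B * (τ - s)) (ε k * B * 1) τ :=
          ((hasDerivAt_id τ).sub_const s).const_mul _
        have h2 : HasDerivAt (fun τ => C * B / a * (Real.exp (-a * s) - Real.exp (-a * τ)))
            (C * B / a * (-(Real.exp (-a * τ) * (-a * 1)))) τ :=
          ((((hasDerivAt_id τ).const_mul (-a)).exp).const_sub _).const_mul _
        refine (h1.add h2).congr_deriv ?_
        field_simp
    have hlim1 : Tendsto (fun k => ‖e t * ⟪toL2 (f k), χ t⟫_ℂ - e s * ⟪toL2 (f k), χ s⟫_ℂ‖) atTop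
        (𝓝 ‖e t * ⟪u, χ t⟫_ℂ - e s * ⟪u, χ s⟫_ℂ‖) :=
      (((hf.inner tendsto_const_nhds).const_mul _).sub
        ((hf.inner tendsto_const_nhds).const_mul _)).norm
    have hlim2 := ((hεlim.mul_const B).mul_const (t - s)).add_const
      (C * B / a * (Real.exp (-a * s) - Real.exp (-a * t)))
    have h1 := le_of_tendsto_of_tendsto' hlim1 hlim2 hk
    rw [zero_mul, zero_mul, zero_add] at h1
    refine h1.trans ?_
    gcongr
    linarith [Real.exp_pos (-a * t)]
  have hlim3 : Tendsto (fun t => e t * ⟪u, χ t⟫_ℂ) atTop (𝓝 0) := by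
    rw [tendsto_zero_iff_norm_tendsto_zero] at hlim ⊢
    simpa [norm_mul, hen] using hlim
  have h1 := le_of_tendsto (hlim3.sub_const (e s * ⟪u, χ s⟫_ℂ)).norm
    ((eventually_ge_atTop s).mono hdiff)
  rwa [zero_sub, norm_neg, norm_mul, hen, one_mul] at h1

/-- Exponential decay of the bound state component of solutions, when the potential differs from
`V` only in half-spaces receding at unit speed. -/
theorem exists_decay {V : Space n → ℝ} (hV : IsPotential V) {v : Space n} (hv : ‖v‖ ≤ 1)
    (R M : ℝ) :
    ∃ a : ℝ, 0 < a ∧ ∃ C : ℝ, 0 ≤ C ∧ ∀ (W : ℝ → Space n →ᵇ ℝ) (χ : ℝ → L2 n) (B : ℝ),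
      IsWeakSol W χ → (∀ t, 0 ≤ t → ‖W t‖ ≤ M) →
      (∀ t x, 0 ≤ t → (W t - hV.toBCF) x ≠ 0 → t - R ≤ ⟪v, x⟫_ℝ) → (∀ t, 0 ≤ t → ‖χ t‖ ≤ B) →
      Tendsto (fun t => ‖Pb V (χ t)‖) atTop (𝓝 0) →
      ∀ t, 0 ≤ t → ‖Pb V (χ t)‖ ≤ C * Real.exp (-a * t) * B := by
  obtain ⟨ι, _, u, E, K, hK, hE, hle, hge⟩ := exists_finite_eigenfunctions hV
  obtain ⟨S, -, hS⟩ := hV.exists_support_bound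
  choose a ha C hC hloc using fun i => exists_localization hS (hE i).1 (hE i).2 hv
  -- A positive number below every a i, valid also when there are no bound states.
  set b : ℝ := (1 + ∑ i, (a i)⁻¹)⁻¹ with hb
  have hsum : 0 ≤ ∑ i, (a i)⁻¹ := Finset.sum_nonneg fun i _ => (inv_pos.2 (ha i)).le
  have hb0 : 0 < b := inv_pos.2 (by linarith)
  have hba : ∀ i, b ≤ a i := fun i => by
    rw [hb]
    refine inv_le_of_inv_le₀ (ha i) ?_
    have := Finset.single_le_sum (f := fun i => (a i)⁻¹) (fun i _ => (inv_pos.2 (ha i)).le)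
      (Finset.mem_univ i)
    linarith
  set L : ℝ := max M 0 + ‖hV.toBCF‖ with hL
  have hL0 : 0 ≤ L := by positivity
  refine ⟨b, hb0, K * ∑ i, C i * Real.exp (a i * R) * L / a i,
    mul_nonneg hK (Finset.sum_nonneg fun i _ => div_nonneg (mul_nonneg (mul_nonneg (hC i)
      (Real.exp_pos _).le) hL0) (ha i).le), fun W χ B hsol hM hsupp hB hlim t ht => ?_⟩
  have hB0 : 0 ≤ B := (norm_nonneg _).trans (hB 0 le_rfl)
  have hi : ∀ i, ‖⟪u i, χ t⟫_ℂ‖ ≤ C i * Real.exp (a i * R) * L / a i * (Real.exp (-b * t) * B) := by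
    intro i
    have hCi : ∀ τ, 0 ≤ τ → ‖mulOp (W τ - hV.toBCF) (u i)‖ ≤
        C i * Real.exp (a i * R) * L * Real.exp (-a i * τ) := by
      intro τ hτ
      -- At time τ the perturbation lives in the half-space at height τ - R; the shift by R costs
      -- the constant factor e^{a i R}.
      refine (hloc i (τ - R) _ fun x hx => hsupp τ x hτ hx).trans ?_
      have h1 : ‖W τ - hV.toBCF‖ ≤ L :=
        (norm_sub_le _ _).trans (add_le_add_left ((hM τ hτ).trans (le_max_left _ _)) _)
      have h2 : Real.exp (-a i * (τ - R)) = Real.exp (a i * R) * Real.exp (-a i * τ) := by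
        rw [← Real.exp_add]; congr 1; ring
      rw [h2]
      calc _ ≤ C i * (Real.exp (a i * R) * Real.exp (-a i * τ)) * L :=
            mul_le_mul_of_nonneg_left h1 (mul_nonneg (hC i) (by positivity))
        _ = _ := by ring
    have hlim' : Tendsto (fun t => ⟪u i, χ t⟫_ℂ) atTop (𝓝 0) := by
      refine squeeze_zero_norm (fun t => hle (χ t) i) ?_
      simpa using hlim.const_mul ‖u i‖
    refine (norm_inner_le_of_tendsto_zero (hE i).2 hsol (ha i) hM hB hCi hlim' ht).trans ?_
    have h3 : Real.exp (-a i * t) ≤ Real.exp (-b * t) :=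
      Real.exp_le_exp.2 (by nlinarith [hba i])
    have h4 : 0 ≤ C i * Real.exp (a i * R) * L / a i :=
      div_nonneg (mul_nonneg (mul_nonneg (hC i) (Real.exp_pos _).le) hL0) (ha i).le
    calc _ = C i * Real.exp (a i * R) * L / a i * (Real.exp (-a i * t) * B) := by ring
      _ ≤ _ := by gcongr
  calc _ ≤ K * ∑ i, ‖⟪u i, χ t⟫_ℂ‖ := hge _
    _ ≤ K * ∑ i, C i * Real.exp (a i * R) * L / a i * (Real.exp (-b * t) * B) := by
      gcongr with i; exact hi i
    _ = _ := by rw [← Finset.sum_mul]; ring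

theorem norm_e₁ (hn : 1 ≤ n) : ‖e₁ n‖ = 1 := by
  have h : e₁ n = EuclideanSpace.single ⟨0, hn⟩ 1 := by
    ext i
    simp [e₁, Fin.ext_iff]
  rw [h]; simp

/-- The Lipschitz bound on V makes the moving potential continuous in time in the sup norm, as
conservation of the norm requires. -/
theorem continuous_translateBCF {V : Space n → ℝ} (hV : IsPotential V) (v : Space n) :
    Continuous fun t : ℝ => translateBCF hV.toBCF (t • v) := by
  obtain ⟨K, hK⟩ := hV.lipschitz
  refine LipschitzWith.continuous (K := K * ‖v‖₊) (LipschitzWith.of_dist_le_mul fun s t => ?_)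
  refine (BoundedContinuousFunction.dist_le (by positivity)).2 fun x => ?_
  refine (hK.dist_le_mul _ _).trans (le_of_eq ?_)
  have h : dist (x - s • v) (x - t • v) = ‖v‖ * dist s t := by
    rw [dist_sub_left, dist_eq_norm, ← sub_smul, norm_smul, mul_comm, dist_eq_norm]
  rw [NNReal.coe_mul, coe_nnnorm, mul_assoc, ← h]
  rfl

end ChargeTransfer

end

/-! ### Combining the rest frame and the moving frame. -/

open ChargeTransfer

theorem proposition3p1 (n : ℕ) (hn : 3 ≤ n) (V₁ V₂ : Space n → ℝ)
    (hV₁ : IsPotential V₁) (hV₂ : IsPotential V₂) :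
    ∃ α : ℝ, 0 < α ∧ ∃ C : ℝ, 0 < C ∧
      ∀ (ψ₀ : L2 n) (ψ : ℝ → L2 n), IsSolution V₁ V₂ ψ₀ ψ →
        AsymptoticallyOrthogonal V₁ V₂ ψ →
          ∀ t : ℝ, 0 ≤ t →
            ‖Pb V₁ (ψ t)‖ + ‖PbMoving V₂ t (ψ t)‖ ≤ C * Real.exp (-α * t) * ‖ψ₀‖ := by
  have he : ‖e₁ n‖ = 1 := norm_e₁ (by omega)
  have hee : inner ℝ (e₁ n) (e₁ n) = 1 := by rw [real_inner_self_eq_norm_sq, he, one_pow]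
  obtain ⟨R₁, -, hR₁⟩ := hV₁.exists_support_bound
  obtain ⟨R₂, -, hR₂⟩ := hV₂.exists_support_bound
  set M : ℝ := ‖hV₁.toBCF‖ + ‖hV₂.toBCF‖
  -- In the rest frame the perturbation of V₁ is V₂(· - t e₁), supported where x₁ ≥ t - R₂.
  obtain ⟨a, ha, A, hA, hdecay₁⟩ := exists_decay hV₁ (v := e₁ n) he.le R₂ M
  -- In the frame of V₂ the perturbation is V₁(· + t e₁), supported where -x₁ ≥ t - R₁.
  obtain ⟨b, hb, B, hB, hdecay₂⟩ := exists_decay hV₂ (v := -e₁ n) (by rw [norm_neg, he]) R₁ M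
  -- A and B may vanish; adding 1 keeps the constant positive.
  refine ⟨min a b, lt_min ha hb, A + B + 1, by linarith, fun ψ₀ ψ hψ horth t ht => ?_⟩
  set W : ℝ → BoundedContinuousFunction (Space n) ℝ :=
    fun t => hV₁.toBCF + translateBCF hV₂.toBCF (t • e₁ n) with hW
  have hsol : IsWeakSol W ψ := hψ.isWeakSol hV₁ hV₂
  have hWM : ∀ t, ‖W t‖ ≤ M := fun t =>
    (norm_add_le _ _).trans (add_le_add_right (norm_translateBCF_le _ _) _)
  have hnorm : ∀ t, 0 ≤ t → ‖ψ t‖ ≤ ‖ψ₀‖ := fun t ht => by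
    rw [hsol.norm_eq hψ.continuousOn
      (continuous_const.add (continuous_translateBCF hV₂ (e₁ n))).continuousOn ht, hψ.initial]
  -- The outer Galilei factor preserves the norm, so the moving projection is measured by the
  -- stationary one applied to the transformed solution.
  have hmov : ∀ t, ‖PbMoving V₂ t (ψ t)‖ = ‖Pb V₂ (galilei (e₁ n) t (ψ t))‖ := fun t =>
    norm_galilei _ _ _
  have h₁ := hdecay₁ W ψ ‖ψ₀‖ hsol (fun t _ => hWM t) (fun t x _ hx => by
      have hx' : V₂ (x - t • e₁ n) ≠ 0 := by simpa [hW] using hx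
      have h2 := (neg_le_of_abs_le (abs_real_inner_le_norm (e₁ n) (x - t • e₁ n)))
      rw [he, one_mul, inner_sub_right, inner_smul_right, hee, mul_one] at h2
      linarith [hR₂ _ hx']) hnorm
    (squeeze_zero (fun _ => norm_nonneg _) (fun t => le_add_of_nonneg_right (norm_nonneg _)) horth)
    t ht
  have h₂ := hdecay₂ (fun t => translateBCF (W t) (t • -e₁ n)) (fun t => galilei (e₁ n) t (ψ t)) ‖ψ₀‖
    (hsol.galilei hψ.continuousOn (e₁ n)) (fun t _ => (norm_translateBCF_le _ _).trans (hWM t))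
    (fun t x _ hx => by
      have hx' : V₁ (x + t • e₁ n) ≠ 0 := by simpa [hW] using hx
      have h2 := le_of_abs_le (abs_real_inner_le_norm (e₁ n) (x + t • e₁ n))
      rw [he, one_mul, inner_add_right, inner_smul_right, hee, mul_one] at h2
      rw [inner_neg_left]
      linarith [hR₁ _ hx']) (fun t ht => by rw [norm_galilei]; exact hnorm t ht)
    (squeeze_zero (fun _ => norm_nonneg _) (fun t => by
      rw [← hmov]; exact le_add_of_nonneg_left (norm_nonneg _)) horth)
    t ht
  rw [hmov]
  have ha' : Real.exp (-a * t) ≤ Real.exp (-min a b * t) :=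
    Real.exp_le_exp.2 (by nlinarith [min_le_left a b])
  have hb' : Real.exp (-b * t) ≤ Real.exp (-min a b * t) :=
    Real.exp_le_exp.2 (by nlinarith [min_le_right a b])
  calc _ ≤ A * Real.exp (-a * t) * ‖ψ₀‖ + B * Real.exp (-b * t) * ‖ψ₀‖ := add_le_add h₁ h₂
    _ ≤ A * Real.exp (-min a b * t) * ‖ψ₀‖ + B * Real.exp (-min a b * t) * ‖ψ₀‖ := by gcongr
    _ ≤ (A + B + 1) * Real.exp (-min a b * t) * ‖ψ₀‖ := by
      have : 0 ≤ Real.exp (-min a b * t) * ‖ψ₀‖ := by positivity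
      nlinarith
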